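/- Conventions. A functor is lex if it preserves finite limits. A category is regular if it has finite limits and coequalizers of kernel pairs, and its regular epimorphisms are stable under pullback; it is exact (in the sense of Barr) if moreover every internal equivalence relation is the kernel pair of some morphism. A functor between regular categories is regular if it preserves finite limits and regular epimorphisms. A morphism $f:A\to A'$ is pure if for every commutative square $f u=v g$ with $g:X\to Y$ a morphism between finitely presentable objects, $u$ factors through $g$. A full subcategory of a locally finitely presentable category is a definable subcategory if it is closed under small products, directed colimits and pure subobjects; a category is definable if it is equivalent to a definable subcategory of some locally finitely presentable category. An object $A$ is injective with respect to $h:X\to Y$ if every morphism $X\to A$ factors through $h$. Theorem. Let $\mathcal B$ be a small exact category. (1) The category $\mathrm{Reg}(\mathcal B,\mathbf{Set})$ of regular functors $\mathcal B\to\mathbf{Set}$ and natural transformations is definable. (2) The category $\mathrm{Lex}(\mathcal B,\mathbf{Set})$ of lex functors $\mathcal B\to\mathbf{Set}$ is locally finitely presentable, the inclusion $\mathrm{Reg}(\mathcal B,\mathbf{Set})\to\mathrm{Lex}(\mathcal B,\mathbf{Set})$ is fully faithful, and its essential image is a finite-injectivity class: it consists of exactly the lex functors that are injective with respect to all the natural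 transformations $(-)\circ h:\mathcal B(B_2,-)\to\mathcal B(B_1,-)$ induced by regular epimorphisms $h:B_1\to B_2$ of $\mathcal B$. These natural transformations form a set, and their domains and codomains are finitely presentable in $\mathrm{Lex}(\mathcal B,\mathbf{Set})$. (3) Let $(\mathrm{Reg}(\mathcal B,\mathbf{Set}),\mathbf{Set})^{\prod\to}$ be the category of functors $\mathrm{Reg}(\mathcal B,\mathbf{Set})\to\mathbf{Set}$ that preserve small products and directed colimits, with natural transformations. Then evaluation, $B\mapsto(F\mapsto F(B))$, is an equivalence $\mathcal B\simeq(\mathrm{Reg}(\mathcal B,\mathbf{Set}),\mathbf{Set})^{\prod\to}$. -/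

import Mathlib

universe w u v u' v'

open CategoryTheory Limits Opposite

namespace DefinableCat

section Exact

/-- A (Barr-)exact category: a regular category in which every internal equivalence relation
is the kernel pair of some morphism. -/
class BarrExact (C : Type u) [Category.{v} C] : Prop extends CategoryTheory.Regular C where
  exists_isKernelPair {R X : C} (p₁ p₂ : R ⟶ X) :
    IsEquivalenceRelation p₁ p₂ → ∃ (Y : C) (f : X ⟶ Y), IsKernelPair f p₁ p₂

/-- Regular functors: functors preserving finite limits and regular epimorphisms. -/
structure IsRegularFunctor {C : Type u} [Category.{v} C] {D : Type u'} [Category.{v'} D]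
    (F : C ⥤ D) : Prop where
  preservesFiniteLimits : PreservesFiniteLimits F
  map_regularEpi {X Y : C} (f : X ⟶ Y) : IsRegularEpi f → IsRegularEpi (F.map f)

/-- Regularity, as a property of the objects of `C ⥤ D`. -/
def regularFunctor (C : Type u) [Category.{v} C] (D : Type u') [Category.{v'} D] :
    ObjectProperty (C ⥤ D) :=
  fun F => IsRegularFunctor F

/-- The category `Reg(C, D)` of regular functors and natural transformations. -/
abbrev RegFunctor (C : Type u) [Category.{v} C] (D : Type u') [Category.{v'} D] :=
  (regularFunctor C D).FullSubcategory

end Exact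

section Definable

variable {K : Type u} [Category.{v} K]

/-- `A` is injective with respect to `h : X ⟶ Y` if every morphism `X ⟶ A` factors through `h`. -/
def IsInjectiveWrt (A : K) {X Y : K} (h : X ⟶ Y) : Prop :=
  ∀ f : X ⟶ A, ∃ g : Y ⟶ A, h ≫ g = f

/-- The class of all objects that are injective with respect to every morphism in `M`. -/
def injectivityClass (M : MorphismProperty K) : ObjectProperty K :=
  fun A => ∀ ⦃X Y : K⦄ (h : X ⟶ Y), M h → IsInjectiveWrt A h

/-- `P` is the finite-injectivity class of `M`: `M` is a (`w`-small) set of morphisms with finitely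
presentable domains and codomains, and `P` consists of the objects injective with respect to `M`. -/
structure IsFiniteInjectivityClassOf (P : ObjectProperty K) (M : MorphismProperty K) : Prop where
  isSmall : MorphismProperty.IsSmall.{w} M
  finitelyPresentable_source {X Y : K} (h : X ⟶ Y) : M h → IsFinitelyPresentable.{w} X
  finitelyPresentable_target {X Y : K} (h : X ⟶ Y) : M h → IsFinitelyPresentable.{w} Y
  eq_injectivityClass : P = injectivityClass M

/-- A morphism `f : A ⟶ B` is (`ℵ₀`-)pure if in each commutative square `u ≫ f = g ≫ v` with
`g : X ⟶ Y` a morphism between finitely presentable objects, `u` factors through `g`. -/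
def IsPureMorphism {A B : K} (f : A ⟶ B) : Prop :=
  ∀ ⦃X Y : K⦄ (g : X ⟶ Y) (u : X ⟶ A) (v : Y ⟶ B),
    IsFinitelyPresentable.{w} X → IsFinitelyPresentable.{w} Y → u ≫ f = g ≫ v →
      ∃ t : Y ⟶ A, g ≫ t = u

/-- A full subcategory of a (locally finitely presentable) category `K` is definable if it is closed
in `K` under (`w`-small) products, directed colimits and pure subobjects. -/
structure IsDefinableSubcategory (P : ObjectProperty K) : Prop where
  products (J : Type w) : P.IsClosedUnderLimitsOfShape (Discrete J)
  directedColimits (J : Type w) [PartialOrder J] [IsDirectedOrder J] [Nonempty J] :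
    P.IsClosedUnderColimitsOfShape J
  pureSubobjects {A B : K} (f : A ⟶ B) [Mono f] : IsPureMorphism.{w} f → P B → P A

/-- A category is definable if it is equivalent to a definable subcategory of a locally finitely
presentable category. -/
def IsDefinableCategory (L : Type u) [Category.{v} L] : Prop :=
  ∃ (K : Type (w + 1)) (_ : Category.{w} K) (_ : IsLocallyFinitelyPresentable.{w} K)
    (P : ObjectProperty K), IsDefinableSubcategory.{w} P ∧ Nonempty (L ≌ P.FullSubcategory)

/-- The functors `L ⥤ Type w` that preserve (`w`-small) products and directed colimits. -/
structure PreservesProductsAndDirectedColimits {L : Type u} [Category.{v} L]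
    (F : L ⥤ Type w) : Prop where
  products (J : Type w) : PreservesLimitsOfShape (Discrete J) F
  directedColimits (J : Type w) [PartialOrder J] [IsDirectedOrder J] [Nonempty J] :
    PreservesColimitsOfShape J F

/-- Preservation of products and directed colimits, as a property of the objects of
`L ⥤ Type w`. -/
def prodDirected (L : Type u) [Category.{v} L] : ObjectProperty (L ⥤ Type w) :=
  fun F => PreservesProductsAndDirectedColimits F

/-- The category `(L, Set)^{∏→}` of functors from `L` to sets that preserve products and directed
colimits, and natural transformations. -/
abbrev Plus (L : Type u) [Category.{v} L] :=
  (prodDirected.{w} L).FullSubcategory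

end Definable

section RegLex

variable (B : Type u) [SmallCategory B]

/-- The inclusion of `Reg(B, Set)` into the category `Lex(B, Set)` of finite limit preserving
functors. -/
abbrev regToLex : RegFunctor B (Type u) ⥤ (B ⥤ₗ Type u) :=
  ObjectProperty.ιOfLE fun _ hF => hF.preservesFiniteLimits

/-- The covariant representable functors, as a functor from `Bᵒᵖ` to `Lex(B, Set)`. -/
def lexCoyoneda : Bᵒᵖ ⥤ (B ⥤ₗ Type u) :=
  ObjectProperty.lift _ coyoneda fun X => by
    rw [leftExactFunctor_iff]
    infer_instance

/-- The morphisms `(-) ∘ h : B(Y, -) ⟶ B(X, -)` of `Lex(B, Set)`, for all regular epimorphisms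
`h : X ⟶ Y` of `B`. -/
inductive regEpiMaps : MorphismProperty (B ⥤ₗ Type u)
  | of {X Y : B} (h : X ⟶ Y) (hh : IsRegularEpi h) : regEpiMaps ((lexCoyoneda B).map h.op)

/-- The evaluation functor, sending `X : B` to the functor `F ↦ F X` on `Reg(B, Set)`. -/
def evaluationFunctor : B ⥤ (RegFunctor B (Type u) ⥤ Type u) :=
  (regularFunctor B (Type u)).ι.flip

end RegLex

end DefinableCat

/-! Parts (1) and (2) are direct. By Yoneda, injectivity of a lex functor with respect to the map
induced by `h` says that the functor sends `h` to a surjection, so the regular functors form a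
finite-injectivity class in `Lex(B, Set)`. Such classes are closed under pure subobjects, while
products and directed colimits are computed pointwise. `Lex(B, Set)` is itself an orthogonality
class of presheaves, for maps between finitely presentable objects.

Part (3) is a definability theorem in the style of model theory, with reduced products in the role
of compactness. The colimit, over a directed set, of the products over its tails is built from
products and directed colimits, so every `M` preserving these commutes with it, and an equation in
the reduced product holds from some index on (`germ_eq_germ_iff`).

Models come from a weak reflection of lex functors into regular ones, under which elements enter no
subobject that did not already contain them (`exists_weakReflection`). For `B(b, -)` it yields
`generic b`, whose distinguished element detects factorisation through monomorphisms; so regular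
functors are jointly conservative. Moreover, `y` can be mapped to the diagonal image of `e` in a
reduced power as soon as `e` lies in every subobject that contains `y` (`exists_map_redProd`).

Consequently a family of subsets of the sets `G b` compatible with morphisms, products and reduced
products is a subobject of `b` (`IsDefinableFamily.exists_mono`). Applied to graphs, this gives
fullness of evaluation. For essential surjectivity, each `x` in `M F` is controlled by a single
element of `F` (`exists_supports`) and comes from a generic functor (`exists_generic_supports`). A
product argument makes one generic functor suffice, so that `M` is a quotient of evaluation at some
`b`. The kernel of this quotient is a subobject of `b ⨯ b` and an equivalence relation; by exactness
it has a quotient in `B`, and evaluation there is `M`. -/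

namespace DefinableCat

/-! ### Elements of limits of sets, and closure properties of regular functors -/

section TypeLemmas

lemma isRegularEpi_types_iff {X Y : Type u} (f : X ⟶ Y) :
    IsRegularEpi f ↔ Function.Surjective f := by
  rw [← epi_iff_surjective]
  exact ⟨fun _ => inferInstance, fun _ => IsRegularEpiCategory.regularEpiOfEpi f⟩

lemma exists_of_isLimit_discrete {J : Type v} {F : Discrete J ⥤ Type u} {c : Cone F}
    (hc : IsLimit c) (x : ∀ j, F.obj ⟨j⟩) : ∃ y : c.pt, ∀ j, c.π.app ⟨j⟩ y = x j := by
  obtain ⟨y, hy, -⟩ := (Types.isLimit_iff c).1 ⟨hc⟩ (fun j => x j.as) (by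
    rintro ⟨j⟩ ⟨j'⟩ ⟨⟨h⟩⟩
    obtain rfl : j = j' := h
    exact F.map_id_apply _ _)
  exact ⟨y, fun j => hy ⟨j⟩⟩

lemma ext_of_isLimit_types {J : Type v} [Category.{v'} J] {F : J ⥤ Type u} {c : Cone F}
    (hc : IsLimit c) {x y : c.pt} (h : ∀ j, c.π.app j x = c.π.app j y) : x = y := by
  have := (Types.isLimit_iff c).1 ⟨hc⟩ (fun j => c.π.app j y) (by
    intro j j' f
    exact ConcreteCategory.congr_hom (c.w f) y)
  exact this.unique h fun _ => rfl

end TypeLemmas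

section Lex

variable {C : Type v} [Category.{v'} C] (F : C ⥤ Type w) [PreservesFiniteLimits F]

lemma exists_of_isPullback {P X Y Z : C} {fst : P ⟶ X} {snd : P ⟶ Y} {f : X ⟶ Z} {g : Y ⟶ Z}
    (h : IsPullback fst snd f g) (x : F.obj X) (y : F.obj Y) (hxy : F.map f x = F.map g y) :
    ∃ p, F.map fst p = x ∧ F.map snd p = y :=
  Types.exists_of_isPullback (h.map F) x y hxy

lemma ext_of_isPullback {P X Y Z : C} {fst : P ⟶ X} {snd : P ⟶ Y} {f : X ⟶ Z} {g : Y ⟶ Z}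
    (h : IsPullback fst snd f g) {p q : F.obj P} (h₁ : F.map fst p = F.map fst q)
    (h₂ : F.map snd p = F.map snd q) : p = q :=
  Types.ext_of_isPullback (h.map F) h₁ h₂

lemma map_injective_of_mono {X Y : C} (m : X ⟶ Y) [Mono m] : Function.Injective (F.map m) := by
  rw [← mono_iff_injective]
  infer_instance

variable [HasFiniteLimits C]

lemma exists_prod (X Y : C) (x : F.obj X) (y : F.obj Y) :
    ∃ p : F.obj (X ⨯ Y), F.map prod.fst p = x ∧ F.map prod.snd p = y := by
  refine exists_of_isPullback F (IsPullback.of_hasBinaryProduct' X Y) x y ?_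
  have : Unique (F.obj (⊤_ C)) :=
    Types.isTerminalEquivUnique _ (terminalIsTerminal.isTerminalObj F (⊤_ C))
  exact Subsingleton.elim _ _

lemma prod_ext {X Y : C} {p q : F.obj (X ⨯ Y)} (h₁ : F.map prod.fst p = F.map prod.fst q)
    (h₂ : F.map prod.snd p = F.map prod.snd q) : p = q :=
  ext_of_isPullback F (IsPullback.of_hasBinaryProduct' X Y) h₁ h₂

end Lex

lemma IsRegularFunctor.surjective {C : Type v} [Category.{v'} C] {F : C ⥤ Type w}
    (hF : IsRegularFunctor F) {X Y : C} (f : X ⟶ Y) (hf : IsRegularEpi f) :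
    Function.Surjective (F.map f) :=
  (isRegularEpi_types_iff _).1 (hF.map_regularEpi f hf)

section Closure

variable {C : Type v} [Category.{v'} C]

/-- Limits commute with limits: a pointwise limit is the flipped diagram followed by `lim`, and both
preserve finite limits. -/
lemma isClosedUnderLimitsOfShape_preservesFiniteLimits (K : Type u') [Category.{u} K]
    [HasLimitsOfShape K (Type w)] :
    (ObjectProperty.preservesFiniteLimits :
      ObjectProperty (C ⥤ Type w)).IsClosedUnderLimitsOfShape K where
  limitsOfShape_le := by
    rintro G ⟨h⟩
    refine ⟨fun J _ _ => ?_⟩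
    have : PreservesLimitsOfShape J h.diag.flip := ⟨fun {F} ↦ ⟨fun {c} hc ↦
      ⟨evaluationJointlyReflectsLimits _ (fun k' ↦ by
        have : PreservesFiniteLimits (h.diag.obj k') := h.prop_diag_obj k'
        exact isLimitOfPreserves (h.diag.obj k') hc)⟩⟩⟩
    let e : h.diag.flip ⋙ lim ≅ G :=
      NatIso.ofComponents
        (fun j ↦ (limit.isLimit (h.diag.flip.obj j)).conePointUniqueUpToIso
          (isLimitOfPreserves ((evaluation _ _).obj j) h.isLimit)) (fun {X Y} f => by
            apply (isLimitOfPreserves ((evaluation C (Type w)).obj Y) h.isLimit).hom_ext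
            intro j
            have h1 := (limit.isLimit (h.diag.flip.obj Y)).conePointUniqueUpToIso_hom_comp
              (isLimitOfPreserves ((evaluation _ _).obj Y) h.isLimit) j
            have h2 := (limit.isLimit (h.diag.flip.obj X)).conePointUniqueUpToIso_hom_comp
              (isLimitOfPreserves ((evaluation _ _).obj X) h.isLimit) j
            rw [Category.assoc, Category.assoc, h1]
            have h3 : G.map f ≫ (((evaluation C (Type w)).obj Y).mapCone h.cone).π.app j =
              (((evaluation C (Type w)).obj X).mapCone h.cone).π.app j ≫ (h.diag.obj j).map f :=
              (h.π.app j).naturality f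
            rw [h3, reassoc_of% h2]
            simp)
    exact preservesLimitsOfShape_of_natIso e

/-- Preimages are chosen coordinate by coordinate; they need satisfy no compatibility because the
shape is discrete. -/
instance isClosedUnderLimitsOfShape_regularFunctor (J : Type w) :
    (regularFunctor C (Type w)).IsClosedUnderLimitsOfShape (Discrete J) where
  limitsOfShape_le := by
    rintro G ⟨h⟩
    refine ⟨?_, fun {X Y} f hf => ?_⟩
    · have := isClosedUnderLimitsOfShape_preservesFiniteLimits (C := C) (Discrete J)
      exact ObjectProperty.limitsOfShape_le
        (P := (ObjectProperty.preservesFiniteLimits : ObjectProperty (C ⥤ Type w)))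
        (J := Discrete J) _
        ⟨h.ofLE fun F (hF : IsRegularFunctor F) => hF.preservesFiniteLimits⟩
    · rw [isRegularEpi_types_iff]
      intro y
      choose x hx using fun j : J => IsRegularFunctor.surjective (h.prop_diag_obj ⟨j⟩) f hf
        ((h.π.app ⟨j⟩).app Y y)
      obtain ⟨z, hz⟩ := exists_of_isLimit_discrete
        (isLimitOfPreserves ((evaluation C (Type w)).obj X) h.isLimit) x
      refine ⟨z, ext_of_isLimit_types
        (isLimitOfPreserves ((evaluation C (Type w)).obj Y) h.isLimit) ?_⟩
      rintro ⟨j⟩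
      exact (NatTrans.naturality_apply (h.π.app ⟨j⟩) f z).trans
        ((congrArg _ (hz j)).trans (hx j))

instance isClosedUnderColimitsOfShape_regularFunctor (J : Type w) [SmallCategory J] [IsFiltered J] :
    (regularFunctor C (Type w)).IsClosedUnderColimitsOfShape J where
  colimitsOfShape_le := by
    rintro G ⟨h⟩
    refine ⟨?_, fun {X Y} f hf => ?_⟩
    · exact ObjectProperty.colimitsOfShape_le
        (P := (ObjectProperty.preservesFiniteLimits : ObjectProperty (C ⥤ Type w)))
        (J := J) _
        ⟨h.ofLE fun F (hF : IsRegularFunctor F) => hF.preservesFiniteLimits⟩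
    · rw [isRegularEpi_types_iff]
      intro y
      obtain ⟨j, y, rfl⟩ := Types.jointly_surjective_of_isColimit
        (isColimitOfPreserves ((evaluation C (Type w)).obj Y) h.isColimit) y
      obtain ⟨x, rfl⟩ := IsRegularFunctor.surjective (h.prop_diag_obj j) f hf y
      exact ⟨(h.ι.app j).app X x, (NatTrans.naturality_apply (h.ι.app j) f x).symm⟩

end Closure

variable (B : Type u) [SmallCategory B]

lemma preserves_evaluationFunctor_obj (b : B) :
    PreservesProductsAndDirectedColimits.{u} ((evaluationFunctor B).obj b) where
  products _ := inferInstanceAs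
    (PreservesLimitsOfShape _ ((regularFunctor B (Type u)).ι ⋙ (evaluation B (Type u)).obj b))
  directedColimits _ _ _ _ := inferInstanceAs
    (PreservesColimitsOfShape _ ((regularFunctor B (Type u)).ι ⋙ (evaluation B (Type u)).obj b))

end DefinableCat

/-! ### Lex functors as directed colimits of representables -/

namespace DefinableCat

/-- A directed inverse system of objects of `B`. -/
structure ProSystem (B : Type u) [SmallCategory B] where
  /-- the index set -/
  ι : Type u
  [partialOrder : PartialOrder ι]
  [isDirectedOrder : IsDirectedOrder ι]
  [nonempty : Nonempty ι]
  /-- the objects of the system -/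
  obj : ι → B
  /-- the transition morphisms -/
  trans {i j : ι} (h : i ≤ j) : obj j ⟶ obj i
  trans_refl (i : ι) : trans (le_refl i) = 𝟙 _
  trans_trans {i j k : ι} (h : i ≤ j) (h' : j ≤ k) : trans h' ≫ trans h = trans (h.trans h')

attribute [instance] ProSystem.partialOrder ProSystem.isDirectedOrder ProSystem.nonempty

variable {B : Type u} [SmallCategory B]

/-- `F` is the colimit of the representables `B(P.obj i, -)`, in terms of elements. -/
structure Presents (P : ProSystem B) (F : B ⥤ Type u) where
  /-- the universal elements -/
  elt (i : P.ι) : F.obj (P.obj i)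
  map_trans_elt {i j : P.ι} (h : i ≤ j) : F.map (P.trans h) (elt j) = elt i
  surj {a : B} (x : F.obj a) : ∃ (i : P.ι) (r : P.obj i ⟶ a), F.map r (elt i) = x
  inj {a : B} {i : P.ι} (r r' : P.obj i ⟶ a) : F.map r (elt i) = F.map r' (elt i) →
    ∃ (j : P.ι) (h : i ≤ j), P.trans h ≫ r = P.trans h ≫ r'

namespace Presents

variable {P : ProSystem B} {F : B ⥤ Type u} (h : Presents P F)

include h in
lemma hom_ext {G : B ⥤ Type u} {f g : F ⟶ G}
    (hfg : ∀ i, f.app _ (h.elt i) = g.app _ (h.elt i)) : f = g := by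
  ext a x
  obtain ⟨i, r, rfl⟩ := h.surj x
  change f.app a _ = g.app a _
  rw [NatTrans.naturality_apply, NatTrans.naturality_apply, hfg]

/-- This is the well-definedness of `desc`, whose definition chooses a representative of each
element. -/
lemma map_eq_map_of_compatible {G : B ⥤ Type u} (g : ∀ i, G.obj (P.obj i))
    (hg : ∀ ⦃i j : P.ι⦄ (hij : i ≤ j), G.map (P.trans hij) (g j) = g i) {a : B} {i j : P.ι}
    (r : P.obj i ⟶ a) (s : P.obj j ⟶ a) (hrs : F.map r (h.elt i) = F.map s (h.elt j)) :
    G.map r (g i) = G.map s (g j) := by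
  obtain ⟨k, hik, hjk⟩ := exists_ge_ge i j
  obtain ⟨l, hkl, hl⟩ := h.inj (P.trans hik ≫ r) (P.trans hjk ≫ s) (by
    rw [Functor.map_comp_apply, Functor.map_comp_apply, h.map_trans_elt, h.map_trans_elt, hrs])
  have := ConcreteCategory.congr_hom (congrArg G.map hl) (g l)
  simpa only [Functor.map_comp_apply, hg] using this

/-- The natural transformation out of a presented functor defined by a compatible family. -/
noncomputable def desc {G : B ⥤ Type u} (g : ∀ i, G.obj (P.obj i))
    (hg : ∀ ⦃i j : P.ι⦄ (hij : i ≤ j), G.map (P.trans hij) (g j) = g i) : F ⟶ G where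
  app a := ↾fun x => G.map (h.surj x).choose_spec.choose (g _)
  naturality a b f := by
    ext x
    change G.map _ _ = G.map f (G.map _ _)
    rw [← Functor.map_comp_apply]
    apply h.map_eq_map_of_compatible g hg
    rw [(h.surj _).choose_spec.choose_spec, Functor.map_comp_apply,
      (h.surj x).choose_spec.choose_spec]
    rfl

lemma desc_app_elt {G : B ⥤ Type u} (g : ∀ i, G.obj (P.obj i))
    (hg : ∀ ⦃i j : P.ι⦄ (hij : i ≤ j), G.map (P.trans hij) (g j) = g i) (i : P.ι) :
    (h.desc g hg).app _ (h.elt i) = g i := by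
  change G.map _ _ = _
  refine (h.map_eq_map_of_compatible g hg _ (𝟙 _) ?_).trans (G.map_id_apply _ _)
  rw [(h.surj _).choose_spec.choose_spec, Functor.map_id_apply]

end Presents

namespace ProSystem

variable (P : ProSystem B)

/-- The diagram of a directed inverse system. -/
def functor : P.ι ⥤ Bᵒᵖ where
  obj i := op (P.obj i)
  map f := (P.trans (leOfHom f)).op
  map_id i := by rw [P.trans_refl]; rfl
  map_comp f g := by rw [← op_comp, P.trans_trans]

/-- The functor presented by a directed inverse system. -/
noncomputable def colim : B ⥤ Type u := colimit (P.functor ⋙ coyoneda)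

lemma preservesFiniteLimits_colim : PreservesFiniteLimits P.colim :=
  ObjectProperty.prop_colimit
    (P := (ObjectProperty.preservesFiniteLimits : ObjectProperty (B ⥤ Type u)))
    (P.functor ⋙ coyoneda) fun i =>
      inferInstanceAs (PreservesFiniteLimits (coyoneda.obj (P.functor.obj i)))

/-- The universal elements of `P.colim`. -/
noncomputable def colimElt (i : P.ι) : P.colim.obj (P.obj i) :=
  (colimit.ι (P.functor ⋙ coyoneda) i).app (P.obj i) (𝟙 (P.obj i))

lemma colim_map_elt {a : B} {i : P.ι} (r : P.obj i ⟶ a) :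
    P.colim.map r (P.colimElt i) = (colimit.ι (P.functor ⋙ coyoneda) i).app a r :=
  (NatTrans.naturality_apply (colimit.ι (P.functor ⋙ coyoneda) i) _ _).symm.trans
    (congrArg ((colimit.ι (P.functor ⋙ coyoneda) i).app a) (Category.id_comp r))

/-- The canonical presentation of `P.colim`. -/
noncomputable def presentsColim : Presents P P.colim where
  elt := P.colimElt
  map_trans_elt {i j} h :=
    ((P.colim_map_elt (P.trans h)).trans (congrArg
      ((colimit.ι (P.functor ⋙ coyoneda) j).app (P.obj i)) (Category.comp_id _).symm)).trans
    (ConcreteCategory.congr_hom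
      (NatTrans.congr_app (colimit.w (P.functor ⋙ coyoneda) (homOfLE h)) (P.obj i)) (𝟙 (P.obj i)))
  surj {a} x := by
    obtain ⟨i, r, rfl⟩ := Types.jointly_surjective_of_isColimit
      (isColimitOfPreserves ((evaluation B (Type u)).obj a)
        (colimit.isColimit (P.functor ⋙ coyoneda))) x
    exact ⟨i, r, P.colim_map_elt r⟩
  inj {a} {i} r r' h := by
    rw [colim_map_elt, colim_map_elt] at h
    obtain ⟨j, f, hf⟩ := (Types.FilteredColimit.isColimit_eq_iff'
      (isColimitOfPreserves ((evaluation B (Type u)).obj a)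
        (colimit.isColimit (P.functor ⋙ coyoneda))) r r').1 h
    exact ⟨j, leOfHom f, hf⟩

end ProSystem

/-- The category of elements of a lex functor is cofiltered, so its opposite receives a final
functor from a directed poset. The two clauses of finality are `surj` and `inj`. -/
lemma exists_presents [HasFiniteLimits B] (F : B ⥤ Type u) [PreservesFiniteLimits F] :
    ∃ P : ProSystem B, Nonempty (Presents P F) := by
  have : IsCofiltered F.Elements := by
    have := flat_of_preservesFiniteLimits F
    exact IsCofiltered.of_equivalence (CategoryOfElements.structuredArrowEquivalence F).symm
  obtain ⟨α, _, _, _, T, hT⟩ := IsFiltered.exists_directed F.Elementsᵒᵖ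
  rw [Functor.final_iff_of_isFiltered] at hT
  obtain ⟨h₁, h₂⟩ := hT
  refine ⟨{ ι := α, obj := fun i => (T.obj i).unop.1, trans := fun h => (T.map (homOfLE h)).unop.1,
            trans_refl := fun i => ?_, trans_trans := fun {i j k} h h' => ?_ },
          ⟨{ elt := fun i => (T.obj i).unop.2, map_trans_elt := fun h => (T.map (homOfLE h)).unop.2,
             surj := fun {a} x => ?_, inj := fun {a i} r r' h => ?_ }⟩⟩
  · change (T.map (𝟙 i)).unop.1 = _
    rw [T.map_id]; rfl
  · rw [← homOfLE_comp h h', T.map_comp]; rfl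
  · obtain ⟨i, ⟨f⟩⟩ := h₁ (op ⟨a, x⟩)
    exact ⟨i, f.unop.1, f.unop.2⟩
  · let s : (T.obj i).unop ⟶ ⟨a, F.map r (T.obj i).unop.2⟩ := ⟨r, rfl⟩
    let s' : (T.obj i).unop ⟶ ⟨a, F.map r (T.obj i).unop.2⟩ := ⟨r', h.symm⟩
    obtain ⟨j, t, ht⟩ := h₂ s.op s'.op
    exact ⟨j, leOfHom t, congrArg (fun f => f.unop.1) ht⟩

end DefinableCat

/-! ### Adjoining preimages along regular epimorphisms -/

namespace DefinableCat

variable {B : Type u} [SmallCategory B]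

/-- `W` is the limit of the diagram formed by the morphisms `q i : X ⟶ Z i` and `p i : Y i ⟶ Z i`,
expressed through the values of finite limit preserving functors. -/
structure IsAmalgam {ι : Type u} {X W : B} {Y Z : ι → B} (p : ∀ i, Y i ⟶ Z i) (q : ∀ i, X ⟶ Z i)
    (π : W ⟶ X) (l : ∀ i, W ⟶ Y i) : Prop where
  strongEpi : StrongEpi π
  w (i : ι) : π ≫ q i = l i ≫ p i
  exists_elt (G : B ⥤ Type u) [PreservesFiniteLimits G] (x : G.obj X) (y : ∀ i, G.obj (Y i)) :
    (∀ i, G.map (q i) x = G.map (p i) (y i)) →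
      ∃ w : G.obj W, G.map π w = x ∧ ∀ i, G.map (l i) w = y i
  elt_ext (G : B ⥤ Type u) [PreservesFiniteLimits G] (w w' : G.obj W) :
    G.map π w = G.map π w' → (∀ i, G.map (l i) w = G.map (l i) w') → w = w'

/-- One index is added at a time by a pullback; regular epimorphisms are pullback-stable, so the
projection to `X` is a composite of strong epimorphisms. Phrasing the universal property through
elements of lex functors lets it compose without limit cones, and representables recover the usual
form. -/
lemma exists_isAmalgam [Regular B] (ι : Type u) [Finite ι] :
    ∀ (X : B) (Y Z : ι → B) (p : ∀ i, Y i ⟶ Z i) (_ : ∀ i, IsRegularEpi (p i)) (q : ∀ i, X ⟶ Z i),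
      ∃ (W : B) (π : W ⟶ X) (l : ∀ i, W ⟶ Y i), IsAmalgam p q π l := by
  induction ι using Finite.induction_empty_option with
  | @of_equiv α β e h =>
    intro X Y Z p hp q
    obtain ⟨W, π, l, H⟩ := h X (fun i => Y (e i)) (fun i => Z (e i)) (fun i => p (e i))
      (fun i => hp _) (fun i => q (e i))
    -- The lifts are transported along `e`; hiding the `eqToHom`s behind an equation leaves `key` as
    -- the only fact needed.
    choose l' hl' using fun j => (⟨eqToHom (by simp) ≫ l (e.symm j) ≫ eqToHom (by simp), rfl⟩ :
      ∃ f : W ⟶ Y j, f = eqToHom (by simp) ≫ l (e.symm j) ≫ eqToHom (by simp))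
    have key : ∀ i, l' (e i) = l i := by
      intro i
      rw [hl']
      have : ∀ k (hk : k = i), eqToHom (rfl : W = W) ≫ l k ≫ eqToHom (by rw [hk]) = l i := by
        rintro k rfl; simp
      exact this _ (e.symm_apply_apply i)
    refine ⟨W, π, l', H.strongEpi, fun j => ?_, fun G _ x y hxy => ?_, fun G _ w w' h₁ h₂ => ?_⟩
    · obtain ⟨i, rfl⟩ := e.surjective j
      rw [key, H.w]
    · obtain ⟨w, h₁, h₂⟩ := H.exists_elt G x (fun i => y (e i)) (fun i => hxy _)
      refine ⟨w, h₁, fun j => ?_⟩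
      obtain ⟨i, rfl⟩ := e.surjective j
      rw [key, h₂]
    · exact H.elt_ext G w w' h₁ fun i => by rw [← key, h₂]
  | h_empty =>
    intro X Y Z p hp q
    refine ⟨X, 𝟙 X, fun i => i.elim, inferInstance, fun i => i.elim, fun G _ x y _ =>
      ⟨x, G.map_id_apply _ _, fun i => i.elim⟩, fun G _ w w' h₁ _ => ?_⟩
    rwa [Functor.map_id_apply, Functor.map_id_apply] at h₁
  | h_option h =>
    intro X Y Z p hp q
    obtain ⟨W, π, l, H⟩ := h X (fun i => Y (some i)) (fun i => Z (some i)) (fun i => p (some i))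
      (fun i => hp _) (fun i => q (some i))
    have := hp none
    have := H.strongEpi
    have hpb := IsPullback.of_hasPullback (π ≫ q none) (p none)
    refine ⟨pullback (π ≫ q none) (p none), pullback.fst _ _ ≫ π,
      fun i => Option.rec (pullback.snd _ _) (fun i => pullback.fst _ _ ≫ l i) i,
      strongEpi_comp _ _, ?_, fun G _ x y hxy => ?_, fun G _ w w' h₁ h₂ => ?_⟩
    · rintro (_ | i)
      · simpa using hpb.w
      · simp [H.w]
    · obtain ⟨w, h₁, h₂⟩ := H.exists_elt G x (fun i => y (some i)) (fun i => hxy _)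
      obtain ⟨v, hv₁, hv₂⟩ := exists_of_isPullback G hpb w (y none) (by
        rw [Functor.map_comp_apply, h₁, hxy])
      refine ⟨v, by rw [Functor.map_comp_apply, hv₁, h₁], ?_⟩
      rintro (_ | i)
      · exact hv₂
      · change G.map (_ ≫ _) v = _
        rw [Functor.map_comp_apply, hv₁, h₂]
    · refine ext_of_isPullback G hpb (H.elt_ext G _ _ ?_ fun i => ?_) (h₂ none)
      · simpa only [Functor.map_comp_apply] using h₁
      · simpa only [Functor.map_comp_apply] using h₂ (some i)

namespace IsAmalgam

variable {ι : Type u} {X W : B} {Y Z : ι → B} {p : ∀ i, Y i ⟶ Z i} {q : ∀ i, X ⟶ Z i}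
    {π : W ⟶ X} {l : ∀ i, W ⟶ Y i} (H : IsAmalgam p q π l)
include H

lemma exists_lift {T : B} (x : T ⟶ X) (y : ∀ i, T ⟶ Y i) (h : ∀ i, x ≫ q i = y i ≫ p i) :
    ∃ w : T ⟶ W, w ≫ π = x ∧ ∀ i, w ≫ l i = y i :=
  H.exists_elt (coyoneda.obj (op T)) x y h

lemma hom_ext {T : B} {w w' : T ⟶ W} (h₁ : w ≫ π = w' ≫ π) (h₂ : ∀ i, w ≫ l i = w' ≫ l i) :
    w = w' :=
  H.elt_ext (coyoneda.obj (op T)) w w' h₁ h₂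

end IsAmalgam

namespace ProSystem

variable [Regular B] (P : ProSystem B)

/-- The regular epimorphisms onto objects of the system. -/
abbrev Cover : Type u := Σ (i : P.ι) (c : B), {p : c ⟶ P.obj i // IsRegularEpi p}

/-- The stages of the system obtained by adjoining lifts along all covers. -/
abbrev CoverIndex : Type u := {x : P.ι × Finset P.Cover // ∀ j ∈ x.2, j.1 ≤ x.1}

lemma exists_coverAmalgam (x : P.CoverIndex) :
    ∃ (W : B) (π : W ⟶ P.obj x.1.1) (l : ∀ j : {j // j ∈ x.1.2}, W ⟶ j.1.2.1),
      IsAmalgam (fun j => j.1.2.2.1) (fun j => P.trans (x.2 j.1 j.2)) π l :=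
  exists_isAmalgam _ _ _ _ _ (fun j => j.1.2.2.2) _

/-- The objects of the system obtained by adjoining lifts along all covers. -/
noncomputable def coverObj (x : P.CoverIndex) : B := (P.exists_coverAmalgam x).choose

/-- The projection from the new system to the old one. -/
noncomputable def coverπ (x : P.CoverIndex) : P.coverObj x ⟶ P.obj x.1.1 :=
  (P.exists_coverAmalgam x).choose_spec.choose

/-- The adjoined lifts. -/
noncomputable def coverLift (x : P.CoverIndex) (j : {j // j ∈ x.1.2}) : P.coverObj x ⟶ j.1.2.1 :=
  (P.exists_coverAmalgam x).choose_spec.choose_spec.choose j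

lemma isAmalgam_cover (x : P.CoverIndex) :
    IsAmalgam (fun j : {j // j ∈ x.1.2} => j.1.2.2.1) (fun j => P.trans (x.2 j.1 j.2))
      (P.coverπ x) (P.coverLift x) :=
  (P.exists_coverAmalgam x).choose_spec.choose_spec.choose_spec

lemma exists_coverTrans {x y : P.CoverIndex} (h : x ≤ y) :
    ∃ t : P.coverObj y ⟶ P.coverObj x, t ≫ P.coverπ x = P.coverπ y ≫ P.trans h.1 ∧
      ∀ j : {j // j ∈ x.1.2}, t ≫ P.coverLift x j = P.coverLift y ⟨j.1, h.2 j.2⟩ := by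
  refine (P.isAmalgam_cover x).exists_lift _ _ fun j => ?_
  rw [Category.assoc, P.trans_trans]
  exact (P.isAmalgam_cover y).w ⟨j.1, h.2 j.2⟩

/-- The transition morphisms of the system obtained by adjoining lifts along all covers. -/
noncomputable def coverTrans {x y : P.CoverIndex} (h : x ≤ y) : P.coverObj y ⟶ P.coverObj x :=
  (P.exists_coverTrans h).choose

lemma coverTrans_π {x y : P.CoverIndex} (h : x ≤ y) :
    P.coverTrans h ≫ P.coverπ x = P.coverπ y ≫ P.trans h.1 :=
  (P.exists_coverTrans h).choose_spec.1

lemma coverTrans_lift {x y : P.CoverIndex} (h : x ≤ y) (j : {j // j ∈ x.1.2}) :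
    P.coverTrans h ≫ P.coverLift x j = P.coverLift y ⟨j.1, h.2 j.2⟩ :=
  (P.exists_coverTrans h).choose_spec.2 j

instance : IsDirectedOrder P.CoverIndex := ⟨fun x y => by
  classical
  obtain ⟨k, hx, hy⟩ := exists_ge_ge x.1.1 y.1.1
  refine ⟨⟨⟨k, x.1.2 ∪ y.1.2⟩, fun j hj => ?_⟩, ⟨hx, Finset.subset_union_left⟩,
    ⟨hy, Finset.subset_union_right⟩⟩
  rcases Finset.mem_union.1 hj with hj | hj
  · exact (x.2 j hj).trans hx
  · exact (y.2 j hj).trans hy⟩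

/-- The system obtained from `P` by adjoining lifts along all covers. -/
noncomputable def cover : ProSystem B where
  ι := P.CoverIndex
  nonempty := ⟨⟨⟨Classical.arbitrary _, ∅⟩, by simp⟩⟩
  obj := P.coverObj
  trans := P.coverTrans
  trans_refl x := (P.isAmalgam_cover x).hom_ext
    (by rw [coverTrans_π, P.trans_refl]; simp) (fun j => by rw [coverTrans_lift]; simp)
  trans_trans {x y z} h h' := (P.isAmalgam_cover x).hom_ext
    (by rw [Category.assoc, coverTrans_π, reassoc_of% P.coverTrans_π, P.trans_trans,
          coverTrans_π])
    (fun j => by rw [Category.assoc, coverTrans_lift, coverTrans_lift, coverTrans_lift])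

/-- The presentation of `P.cover.colim`, restated with `coverObj` and `coverTrans` in place of the
fields of `P.cover`. -/
lemma exists_functor_cover :
    ∃ (F : B ⥤ Type u) (_ : PreservesFiniteLimits F) (e : ∀ x, F.obj (P.coverObj x)),
      (∀ ⦃x y⦄ (h : x ≤ y), F.map (P.coverTrans h) (e y) = e x) ∧
      (∀ ⦃a⦄ (z : F.obj a), ∃ (x : P.CoverIndex) (r : P.coverObj x ⟶ a), F.map r (e x) = z) ∧
      (∀ ⦃a x⦄ (r r' : P.coverObj x ⟶ a), F.map r (e x) = F.map r' (e x) →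
        ∃ (y : P.CoverIndex) (h : x ≤ y), P.coverTrans h ≫ r = P.coverTrans h ≫ r') ∧
      ∀ (G : B ⥤ Type u) (v : ∀ x, G.obj (P.coverObj x)),
        (∀ ⦃x y⦄ (h : x ≤ y), G.map (P.coverTrans h) (v y) = v x) →
        ∃ f : F ⟶ G, ∀ x, f.app _ (e x) = v x :=
  let h := P.cover.presentsColim
  ⟨P.cover.colim, P.cover.preservesFiniteLimits_colim, h.elt, fun _ _ => h.map_trans_elt,
    fun _ => h.surj, fun _ _ => h.inj, fun _ v hv => ⟨h.desc v hv, h.desc_app_elt v hv⟩⟩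

end ProSystem

/-- The property of `η : F ⟶ F'` that it reflects membership in subobjects. -/
def ReflectsMono {F F' : B ⥤ Type u} (η : F ⟶ F') : Prop :=
  ∀ ⦃t a : B⦄ (m : t ⟶ a) [Mono m] (x : F.obj a),
    η.app a x ∈ Set.range (F'.map m) → x ∈ Set.range (F.map m)

/-- In the colimit over `P.cover`, every element of `F` acquires preimages along all regular
epimorphisms. Maps to a regular `G` extend because the covers can be lifted in `G`, and no new
membership in a subobject arises because the projections `coverπ` are strong epimorphisms. -/
lemma exists_adjoin_lifts [Regular B] (F : B ⥤ Type u) [PreservesFiniteLimits F] :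
    ∃ (F' : B ⥤ Type u) (η : F ⟶ F'), PreservesFiniteLimits F' ∧
      (∀ ⦃c c' : B⦄ (p : c ⟶ c') (_ : IsRegularEpi p) (z : F.obj c'),
        η.app c' z ∈ Set.range (F'.map p)) ∧ ReflectsMono η ∧
      ∀ (G : B ⥤ Type u) (_ : IsRegularFunctor G) (f : F ⟶ G), ∃ f' : F' ⟶ G, η ≫ f' = f := by
  obtain ⟨P, ⟨h⟩⟩ := exists_presents F
  obtain ⟨F', hF', e, he, hsurj, hinj, hdesc⟩ := P.exists_functor_cover
  -- The stages with no cover form a copy of the old system, through which `F` maps to `F'`.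
  let x₀ (i : P.ι) : P.CoverIndex := ⟨⟨i, ∅⟩, by simp⟩
  let g (i : P.ι) : F'.obj (P.obj i) := F'.map (P.coverπ (x₀ i)) (e (x₀ i))
  have hg' (x : P.CoverIndex) : F'.map (P.coverπ x) (e x) = g x.1.1 := by
    have hx : x₀ x.1.1 ≤ x := ⟨le_rfl, by simp [x₀]⟩
    have h1 := P.coverTrans_π hx
    rw [P.trans_refl, Category.comp_id] at h1
    dsimp only [g]
    rw [← h1, Functor.map_comp_apply, he]
  have hg ⦃i j : P.ι⦄ (hij : i ≤ j) : F'.map (P.trans hij) (g j) = g i := by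
    have hx : x₀ i ≤ x₀ j := ⟨hij, le_rfl⟩
    dsimp only [g]
    rw [← Functor.map_comp_apply, ← P.coverTrans_π hx, Functor.map_comp_apply, he]
  let η : F ⟶ F' := h.desc g hg
  refine ⟨F', η, hF', ?_, ?_, ?_⟩
  · intro c c' p hp z
    obtain ⟨i, r, rfl⟩ := h.surj z
    -- Lifting `z` along `p` amounts to lifting the universal element along the pullback of `p`,
    -- which is a cover of stage `i`.
    let j : P.Cover := ⟨i, pullback r p, pullback.fst r p, inferInstance⟩
    let x : P.CoverIndex := ⟨⟨i, {j}⟩, fun k hk => by rw [Finset.mem_singleton.1 hk]⟩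
    refine ⟨F'.map (P.coverLift x ⟨j, Finset.mem_singleton_self j⟩ ≫ pullback.snd r p)
      (e x), ?_⟩
    have h1 : P.coverπ x ≫ P.trans le_rfl = P.coverLift x ⟨j, Finset.mem_singleton_self j⟩ ≫
      pullback.fst r p := (P.isAmalgam_cover x).w ⟨j, Finset.mem_singleton_self j⟩
    rw [P.trans_refl, Category.comp_id] at h1
    rw [NatTrans.naturality_apply, h.desc_app_elt, ← hg' x, ← Functor.map_comp_apply,
      ← Functor.map_comp_apply, Category.assoc, ← pullback.condition, h1, Category.assoc]
  · intro t a m _ x hx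
    obtain ⟨y, hy⟩ := hx
    obtain ⟨i, r, rfl⟩ := h.surj x
    obtain ⟨k, s, rfl⟩ := hsurj y
    rw [NatTrans.naturality_apply, h.desc_app_elt] at hy
    obtain ⟨z, hz₁, hz₂⟩ := exists_ge_ge (x₀ i) k
    have hz₁' : i ≤ z.1.1 := hz₁.1
    obtain ⟨z', hz', hs⟩ := hinj ((P.coverTrans hz₂ ≫ s) ≫ m)
      (P.coverπ z ≫ P.trans hz₁' ≫ r) (by
        rw [Functor.map_comp_apply, Functor.map_comp_apply, he, hy,
          Functor.map_comp_apply, hg' z, Functor.map_comp_apply, hg])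
    rw [reassoc_of% P.coverTrans_π] at hs
    have := (P.isAmalgam_cover z').strongEpi
    -- The witness of membership lives above the projection `coverπ`; since that is a strong
    -- epimorphism and `m` is mono, the diagonal brings it down to a stage of `P`.
    have sq : CommSq (P.coverTrans hz' ≫ P.coverTrans hz₂ ≫ s) (P.coverπ z') m
      (P.trans hz'.1 ≫ P.trans hz₁' ≫ r) := ⟨by simpa using hs⟩
    refine ⟨F.map sq.lift (h.elt z'.1.1), ?_⟩
    rw [← Functor.map_comp_apply, sq.fac_right, Functor.map_comp_apply, Functor.map_comp_apply,
      h.map_trans_elt, h.map_trans_elt]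
  · intro G hG f
    have := hG.preservesFiniteLimits
    -- One preimage per cover is fixed once and for all, which makes the family `v` below
    -- compatible.
    choose k hk using fun j : P.Cover => hG.surjective j.2.2.1 j.2.2.2 (f.app _ (h.elt j.1))
    have hf ⦃i j : P.ι⦄ (hij : i ≤ j) : G.map (P.trans hij) (f.app _ (h.elt j)) =
        f.app _ (h.elt i) := by
      rw [← NatTrans.naturality_apply, h.map_trans_elt]
    choose v hv₁ hv₂ using fun x : P.CoverIndex => (P.isAmalgam_cover x).exists_elt G
      (f.app _ (h.elt x.1.1)) (fun j => k j.1) (fun j => by rw [hf, hk])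
    obtain ⟨f', hf'⟩ := hdesc G v fun x y hxy =>
      (P.isAmalgam_cover x).elt_ext G _ _
        (by rw [← Functor.map_comp_apply, P.coverTrans_π, Functor.map_comp_apply, hv₁, hv₁, hf])
        (fun j => by rw [← Functor.map_comp_apply, P.coverTrans_lift, hv₂, hv₂])
    refine ⟨f', h.hom_ext fun i => ?_⟩
    rw [NatTrans.comp_app_apply, h.desc_app_elt]
    dsimp only [g]
    rw [NatTrans.naturality_apply, hf', hv₁]

end DefinableCat

/-! ### The weak reflection into regular functors, and generic elements -/

namespace DefinableCat

variable {B : Type u} [SmallCategory B]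

section Chain

variable (X : ℕ → B ⥤ Type u) (η : ∀ n, X n ⟶ X (n + 1))

/-- The colimit of a sequence of functors. -/
noncomputable def seqColim : B ⥤ Type u := colimit (Functor.ofSequence η)

/-- The inclusions into the colimit of a sequence of functors. -/
noncomputable def seqι (n : ℕ) : X n ⟶ seqColim X η := colimit.ι (Functor.ofSequence η) n

lemma seqι_succ (n : ℕ) : η n ≫ seqι X η (n + 1) = seqι X η n := by
  have := colimit.w (Functor.ofSequence η) (homOfLE n.le_succ)
  rwa [Functor.ofSequence_map_homOfLE_succ] at this

lemma seqι_surj {a : B} (x : (seqColim X η).obj a) :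
    ∃ (n : ℕ) (y : (X n).obj a), (seqι X η n).app a y = x :=
  Types.jointly_surjective_of_isColimit (isColimitOfPreserves ((evaluation B (Type u)).obj a)
    (colimit.isColimit (Functor.ofSequence η))) x

lemma preservesFiniteLimits_seqColim (h : ∀ n, PreservesFiniteLimits (X n)) :
    PreservesFiniteLimits (seqColim X η) :=
  ⟨fun J _ _ => ObjectProperty.prop_colimit
    (P := (ObjectProperty.preservesLimitsOfShape J : ObjectProperty (B ⥤ Type u)))
    (Functor.ofSequence η) fun n => (h n).preservesFiniteLimits J⟩

lemma exists_seqDesc {G : B ⥤ Type u} (f : ∀ n, X n ⟶ G) (hf : ∀ n, η n ≫ f (n + 1) = f n) :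
    ∃ g : seqColim X η ⟶ G, ∀ n, seqι X η n ≫ g = f n :=
  ⟨colimit.desc (Functor.ofSequence η) ⟨G, NatTrans.ofSequence f fun n => by
    rw [Functor.ofSequence_map_homOfLE_succ]
    exact (hf n).trans (Category.comp_id _).symm⟩, fun _ => colimit.ι_desc _ _⟩

lemma reflectsMono_seqι_zero (h : ∀ n, ReflectsMono (η n)) : ReflectsMono (seqι X η 0) := by
  have key : ∀ (n : ℕ) ⦃t a : B⦄ (m : t ⟶ a) [Mono m] (x : (X 0).obj a),
      ((Functor.ofSequence η).map (homOfLE n.zero_le)).app a x ∈ Set.range ((X n).map m) →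
        x ∈ Set.range ((X 0).map m) := by
    intro n
    induction n with
    | zero =>
      intro t a m _ x hx
      have : (Functor.ofSequence η).map (homOfLE (Nat.zero_le 0)) = 𝟙 _ :=
        (Functor.ofSequence η).map_id 0
      rw [this] at hx
      exact hx
    | succ n ih =>
      intro t a m _ x hx
      refine ih m x (h n m _ ?_)
      have : homOfLE (Nat.zero_le (n + 1)) = homOfLE n.zero_le ≫ homOfLE n.le_succ := rfl
      rw [this, Functor.map_comp, Functor.ofSequence_map_homOfLE_succ] at hx
      exact hx
  intro t a m _ x ⟨y, hy⟩
  obtain ⟨n, y, rfl⟩ := seqι_surj X η y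
  rw [← NatTrans.naturality_apply] at hy
  obtain ⟨k, f, g, hfg⟩ := (Types.FilteredColimit.isColimit_eq_iff _
    (isColimitOfPreserves ((evaluation B (Type u)).obj a)
      (colimit.isColimit (Functor.ofSequence η)))).1 hy
  refine key k m x ⟨((Functor.ofSequence η).map f).app _ y, ?_⟩
  exact (NatTrans.naturality_apply ((Functor.ofSequence η).map f) m y).symm.trans hfg

end Chain

/-- Every finite limit preserving functor on a regular category has a weak reflection into the
regular functors, which reflects membership in subobjects. -/
lemma exists_weakReflection [Regular B] (F : B ⥤ Type u) (hF : PreservesFiniteLimits F) :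
    ∃ (G : B ⥤ Type u) (η : F ⟶ G), IsRegularFunctor G ∧ ReflectsMono η ∧
      ∀ (H : B ⥤ Type u) (_ : IsRegularFunctor H) (f : F ⟶ H), ∃ g : G ⟶ H, η ≫ g = f := by
  choose S σ hS hlift hrefl hext using
    fun F : {F : B ⥤ Type u // PreservesFiniteLimits F} =>
      have := F.2
      exists_adjoin_lifts F.1
  -- Elements of stage `n` acquire their preimages at stage `n + 1`, so the colimit of the sequence
  -- is regular.
  let X (n : ℕ) : {F : B ⥤ Type u // PreservesFiniteLimits F} :=
    Nat.rec ⟨F, hF⟩ (fun _ F => ⟨S F, hS F⟩) n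
  let Y (n : ℕ) : B ⥤ Type u := (X n).1
  let η (n : ℕ) : Y n ⟶ Y (n + 1) := σ (X n)
  refine ⟨seqColim Y η, seqι Y η 0, ⟨preservesFiniteLimits_seqColim Y η fun n => (X n).2,
    fun {c c'} p hp => ?_⟩, reflectsMono_seqι_zero Y η fun n => hrefl (X n), ?_⟩
  · rw [isRegularEpi_types_iff]
    intro z
    obtain ⟨n, z, rfl⟩ := seqι_surj Y η z
    obtain ⟨y, hy⟩ := hlift (X n) p hp z
    refine ⟨(seqι Y η (n + 1)).app c y, ?_⟩
    rw [← NatTrans.naturality_apply, ← seqι_succ Y η n, NatTrans.comp_app_apply]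
    exact congrArg ((seqι Y η (n + 1)).app c') hy
  · intro H hH f
    choose e he using fun (n : ℕ) (f : Y n ⟶ H) => hext (X n) H hH f
    let f' (n : ℕ) : Y n ⟶ H := Nat.rec f (fun n f => e n f) n
    obtain ⟨g, hg⟩ := exists_seqDesc Y η f' fun n => he n (f' n)
    exact ⟨g, hg 0⟩

/-- A regular functor with an element of its value at `b` which is weakly universal, and which
lies in the image of a subobject only if it has to. -/
lemma exists_generic [Regular B] (b : B) :
    ∃ (G : RegFunctor B (Type u)) (e : G.obj.obj b),
      (∀ (H : RegFunctor B (Type u)) (z : H.obj.obj b), ∃ f : G ⟶ H, f.hom.app b e = z) ∧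
      ∀ ⦃t a : B⦄ (m : t ⟶ a) [Mono m] (r : b ⟶ a),
        G.obj.map r e ∈ Set.range (G.obj.map m) → ∃ s : b ⟶ t, s ≫ m = r := by
  obtain ⟨G, η, hG, hη, hext⟩ := exists_weakReflection (coyoneda.obj (op b)) inferInstance
  refine ⟨⟨G, hG⟩, η.app b (𝟙 b), fun H z => ?_, fun t a m _ r hr => ?_⟩
  · obtain ⟨g, hg⟩ := hext H.obj H.property (coyonedaEquiv.symm z)
    refine ⟨ObjectProperty.homMk g, ?_⟩
    have := ConcreteCategory.congr_hom (NatTrans.congr_app hg b) (𝟙 b)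
    refine this.trans ?_
    exact coyonedaEquiv.apply_symm_apply z
  · have h1 : G.map r (η.app b (𝟙 b)) = η.app a r :=
      (NatTrans.naturality_apply η r (𝟙 b)).symm.trans
        (congrArg (η.app a) (Category.id_comp r))
    dsimp only at hr
    rw [h1] at hr
    exact hη m r hr

end DefinableCat

/-! ### Reduced products modulo the filter of tails -/

namespace DefinableCat

variable {B : Type u} [SmallCategory B]

section Products

variable {M : RegFunctor B (Type u) ⥤ Type u}
  {J : Type u} (E : J → RegFunctor B (Type u))

lemma exists_elt_of_family (hM : PreservesProductsAndDirectedColimits.{u} M)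
    (x : ∀ j, M.obj (E j)) :
    ∃ y : M.obj (∏ᶜ E), ∀ j, M.map (Pi.π E j) y = x j := by
  have := hM.products J
  exact exists_of_isLimit_discrete (isLimitOfPreserves M (limit.isLimit (Discrete.functor E))) x

lemma elt_family_ext (hM : PreservesProductsAndDirectedColimits.{u} M)
    {x y : M.obj (∏ᶜ E)}
    (h : ∀ j, M.map (Pi.π E j) x = M.map (Pi.π E j) y) : x = y := by
  have := hM.products J
  exact ext_of_isLimit_types (isLimitOfPreserves M (limit.isLimit (Discrete.functor E)))
    fun ⟨j⟩ => h j

end Products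

section ReducedProduct

variable {D : Type u} [PartialOrder D]
  (E : D → RegFunctor B (Type u))

/-- The products over the tails of a directed set. -/
noncomputable def tailFunctor : D ⥤ RegFunctor B (Type u) where
  obj i := ∏ᶜ fun j : Set.Ici i => E j
  map {i i'} f := Pi.lift fun j => Pi.π (fun j : Set.Ici i => E j) ⟨j, (leOfHom f).trans j.2⟩
  map_id i := Pi.hom_ext _ _ fun j => by simp
  map_comp f g := Pi.hom_ext _ _ fun j => by simp

/-- The projections from a product over a tail. -/
noncomputable def tailπ (i : D) (j : Set.Ici i) : (tailFunctor E).obj i ⟶ E j :=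
  Pi.π (fun j : Set.Ici i => E j) j

@[simp]
lemma tailFunctor_map_tailπ {i i' : D} (f : i ⟶ i') (j : Set.Ici i') :
    (tailFunctor E).map f ≫ tailπ E i' j = tailπ E i ⟨j, (leOfHom f).trans j.2⟩ :=
  Pi.lift_π _ _

variable {M : RegFunctor B (Type u) ⥤ Type u} {E}

lemma exists_tail (hM : PreservesProductsAndDirectedColimits.{u} M)
    (i : D) (x : ∀ j : Set.Ici i, M.obj (E j)) :
    ∃ y : M.obj ((tailFunctor E).obj i), ∀ j, M.map (tailπ E i j) y = x j :=
  exists_elt_of_family (fun j : Set.Ici i => E j) hM x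

lemma tail_ext (hM : PreservesProductsAndDirectedColimits.{u} M)
    {i : D} {x y : M.obj ((tailFunctor E).obj i)}
    (h : ∀ j, M.map (tailπ E i j) x = M.map (tailπ E i j) y) : x = y :=
  elt_family_ext (fun j : Set.Ici i => E j) hM h

/-- The functoriality of products over tails. -/
noncomputable def tailMap {E' : D → RegFunctor B (Type u)} (f : ∀ j, E j ⟶ E' j) (i : D) :
    (tailFunctor E).obj i ⟶ (tailFunctor E').obj i :=
  Pi.lift fun j : Set.Ici i => tailπ E i j ≫ f j

@[simp]
lemma tailMap_tailπ {E' : D → RegFunctor B (Type u)} (f : ∀ j, E j ⟶ E' j) (i : D)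
    (j : Set.Ici i) : tailMap f i ≫ tailπ E' i j = tailπ E i j ≫ f j :=
  Pi.lift_π _ _

variable (D) in
/-- The diagonal morphism into a product over a tail. -/
noncomputable def tailDiag (F : RegFunctor B (Type u)) (i : D) :
    F ⟶ (tailFunctor fun _ : D => F).obj i :=
  Pi.lift fun _ : Set.Ici i => 𝟙 F

variable (D) in
lemma tailDiag_tailπ (F : RegFunctor B (Type u)) (i : D) (j : Set.Ici i) :
    tailDiag D F i ≫ tailπ (fun _ : D => F) i j = 𝟙 F :=
  Pi.lift_π _ _

variable [IsDirectedOrder D] [Nonempty D]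

variable (E) in
/-- The reduced product of a family of regular functors, modulo the filter of tails. -/
noncomputable def redProd : RegFunctor B (Type u) := colimit (tailFunctor E)

variable (E) in
/-- The morphisms from products over tails to the reduced product. -/
noncomputable def redι (i : D) : (tailFunctor E).obj i ⟶ redProd E := colimit.ι (tailFunctor E) i

/-- The element of (the value of `M` at) a reduced product determined by a family of elements
indexed by a tail. -/
noncomputable def germ (hM : PreservesProductsAndDirectedColimits.{u} M)
    (i : D) (x : ∀ j : Set.Ici i, M.obj (E j)) : M.obj (redProd E) :=
  M.map (redι E i) (exists_tail hM i x).choose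

lemma germ_eq (hM : PreservesProductsAndDirectedColimits.{u} M)
    (i : D) (x : ∀ j : Set.Ici i, M.obj (E j)) (y : M.obj ((tailFunctor E).obj i))
    (hy : ∀ j, M.map (tailπ E i j) y = x j) :
    germ hM i x = M.map (redι E i) y := by
  rw [germ]
  congr 1
  exact tail_ext hM fun j => ((exists_tail hM i x).choose_spec j).trans (hy j).symm

lemma exists_germ (hM : PreservesProductsAndDirectedColimits.{u} M)
    (w : M.obj (redProd E)) :
    ∃ (i : D) (x : ∀ j : Set.Ici i, M.obj (E j)), germ hM i x = w := by
  have := hM.directedColimits D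
  obtain ⟨i, y, rfl⟩ := Types.jointly_surjective_of_isColimit
    (isColimitOfPreserves M (colimit.isColimit (tailFunctor E))) w
  exact ⟨i, fun j => M.map (tailπ E i j) y, germ_eq hM i _ y fun _ => rfl⟩

/-- Together with `exists_germ`: `M` takes the reduced product to the reduced product of sets, as it
preserves the products over tails and their directed colimit. -/
lemma germ_eq_germ_iff (hM : PreservesProductsAndDirectedColimits.{u} M)
    (i i' : D) (x : ∀ j : Set.Ici i, M.obj (E j))
    (x' : ∀ j : Set.Ici i', M.obj (E j)) :
    germ hM i x = germ hM i' x' ↔ ∃ (k : D) (h : i ≤ k) (h' : i' ≤ k), ∀ j (hj : k ≤ j),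
      x ⟨j, h.trans hj⟩ = x' ⟨j, h'.trans hj⟩ := by
  have := hM.directedColimits D
  obtain ⟨y, hy⟩ := exists_tail hM i x
  obtain ⟨y', hy'⟩ := exists_tail hM i' x'
  rw [germ_eq hM i x y hy, germ_eq hM i' x' y' hy']
  refine (Types.FilteredColimit.isColimit_eq_iff _
    (isColimitOfPreserves M (colimit.isColimit (tailFunctor E)))).trans ?_
  constructor
  · rintro ⟨k, f, g, hfg⟩
    refine ⟨k, leOfHom f, leOfHom g, fun j hj => ?_⟩
    have := congrArg (M.map (tailπ E k ⟨j, hj⟩)) hfg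
    dsimp only [Functor.comp_map] at this
    rw [← Functor.map_comp_apply, ← Functor.map_comp_apply, tailFunctor_map_tailπ,
      tailFunctor_map_tailπ, hy, hy'] at this
    exact this
  · rintro ⟨k, h, h', H⟩
    refine ⟨k, homOfLE h, homOfLE h', tail_ext hM fun j => ?_⟩
    dsimp only [Functor.comp_map]
    rw [← Functor.map_comp_apply, ← Functor.map_comp_apply, tailFunctor_map_tailπ,
      tailFunctor_map_tailπ, hy, hy']
    exact H j j.2

lemma germ_restrict (hM : PreservesProductsAndDirectedColimits.{u} M)
    {i k : D} (h : i ≤ k) (x : ∀ j : Set.Ici i, M.obj (E j)) :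
    germ hM i x = germ hM k fun j => x ⟨j, h.trans j.2⟩ :=
  (germ_eq_germ_iff hM _ _ _ _).2 ⟨k, h, le_rfl, fun _ _ => rfl⟩

lemma app_germ (hM : PreservesProductsAndDirectedColimits.{u} M)
    {N : RegFunctor B (Type u) ⥤ Type u}
    (hN : PreservesProductsAndDirectedColimits.{u} N) (α : M ⟶ N) (i : D)
    (x : ∀ j : Set.Ici i, M.obj (E j)) :
    α.app _ (germ hM i x) = germ hN i fun j => α.app _ (x j) := by
  obtain ⟨y, hy⟩ := exists_tail hM i x
  rw [germ_eq hM i x y hy, NatTrans.naturality_apply]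
  symm
  apply germ_eq
  intro j
  rw [← NatTrans.naturality_apply, hy]

/-- The natural transformation between products over tails. -/
noncomputable def tailNatTrans {E' : D → RegFunctor B (Type u)} (f : ∀ j, E j ⟶ E' j) :
    tailFunctor E ⟶ tailFunctor E' where
  app := tailMap f
  naturality i i' g := Pi.hom_ext _ _ fun j => by
    change ((tailFunctor E).map g ≫ tailMap f i') ≫ tailπ E' i' j =
      (tailMap f i ≫ (tailFunctor E').map g) ≫ tailπ E' i' j
    rw [Category.assoc, Category.assoc, tailMap_tailπ, tailFunctor_map_tailπ, tailMap_tailπ,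
      ← tailFunctor_map_tailπ E g j, Category.assoc]

/-- The functoriality of reduced products. -/
noncomputable def redProdMap {E' : D → RegFunctor B (Type u)} (f : ∀ j, E j ⟶ E' j) :
    redProd E ⟶ redProd E' :=
  colimMap (tailNatTrans f)

lemma redι_redProdMap {E' : D → RegFunctor B (Type u)} (f : ∀ j, E j ⟶ E' j) (i : D) :
    redι E i ≫ redProdMap f = tailMap f i ≫ redι E' i :=
  ι_colimMap (tailNatTrans f) i

lemma map_redProdMap_germ (hM : PreservesProductsAndDirectedColimits.{u} M)
    {E' : D → RegFunctor B (Type u)} (f : ∀ j, E j ⟶ E' j) (i : D)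
    (x : ∀ j : Set.Ici i, M.obj (E j)) :
    M.map (redProdMap f) (germ hM i x) = germ hM i fun j => M.map (f j) (x j) := by
  obtain ⟨y, hy⟩ := exists_tail hM i x
  rw [germ_eq hM i x y hy, ← Functor.map_comp_apply, redι_redProdMap,
    Functor.map_comp_apply]
  symm
  apply germ_eq
  intro j
  rw [← Functor.map_comp_apply, tailMap_tailπ, Functor.map_comp_apply, hy]

variable (D) in
/-- The diagonal morphism into a reduced power. -/
noncomputable def redDiag (F : RegFunctor B (Type u)) : F ⟶ redProd fun _ : D => F :=
  tailDiag D F (Classical.arbitrary D) ≫ redι (fun _ : D => F) (Classical.arbitrary D)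

lemma map_redDiag (hM : PreservesProductsAndDirectedColimits.{u} M)
    {F : RegFunctor B (Type u)} (x : M.obj F) (i : D) :
    M.map (redDiag D F) x = germ hM (E := fun _ => F) i fun _ => x := by
  have h1 : M.map (redDiag D F) x =
      germ hM (E := fun _ => F) (Classical.arbitrary D) fun _ => x := by
    rw [redDiag, Functor.map_comp_apply]
    symm
    apply germ_eq
    intro j
    rw [← Functor.map_comp_apply, tailDiag_tailπ, Functor.map_id_apply]
  rw [h1, germ_eq_germ_iff]
  obtain ⟨k, h, h'⟩ := exists_ge_ge (Classical.arbitrary D) i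
  exact ⟨k, h, h', fun _ _ => rfl⟩

lemma map_redDiag_injective (hM : PreservesProductsAndDirectedColimits.{u} M)
    (F : RegFunctor B (Type u)) :
    Function.Injective (M.map (redDiag D F)) := by
  intro x y h
  rw [map_redDiag hM x (Classical.arbitrary D), map_redDiag hM y (Classical.arbitrary D),
    germ_eq_germ_iff] at h
  obtain ⟨k, -, -, h⟩ := h
  exact h k le_rfl

/-- The elements of a reduced product of regular functors. -/
noncomputable def evGerm {b : B} (i : D) (x : ∀ j : Set.Ici i, (E j).obj.obj b) :
    (redProd E).obj.obj b :=
  germ (preserves_evaluationFunctor_obj B b) i x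

variable {b : B}

lemma evGerm_restrict {i k : D} (h : i ≤ k) (x : ∀ j : Set.Ici i, (E j).obj.obj b) :
    evGerm i x = evGerm k fun j => x ⟨j, h.trans j.2⟩ :=
  germ_restrict (preserves_evaluationFunctor_obj B b) h x

lemma map_evGerm {c : B} (f : b ⟶ c) (i : D) (x : ∀ j : Set.Ici i, (E j).obj.obj b) :
    (redProd E).obj.map f (evGerm i x) = evGerm i fun j => (E j).obj.map f (x j) :=
  app_germ (preserves_evaluationFunctor_obj B b) (preserves_evaluationFunctor_obj B c)
    ((evaluationFunctor B).map f) i x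

lemma redProdMap_evGerm {E' : D → RegFunctor B (Type u)} (f : ∀ j, E j ⟶ E' j) (i : D)
    (x : ∀ j : Set.Ici i, (E j).obj.obj b) :
    (redProdMap f).hom.app b (evGerm i x) = evGerm i fun j => (f j).hom.app b (x j) :=
  map_redProdMap_germ (preserves_evaluationFunctor_obj B b) f i x

lemma redDiag_app {F : RegFunctor B (Type u)} (x : F.obj.obj b) (i : D) :
    (redDiag D F).hom.app b x = evGerm (E := fun _ => F) i fun _ => x :=
  map_redDiag (preserves_evaluationFunctor_obj B b) x i

lemma redDiag_naturality {F G : RegFunctor B (Type u)} (f : F ⟶ G) :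
    redDiag D F ≫ redProdMap (fun _ => f) = f ≫ redDiag D G := by
  ext b x
  change (redProdMap _).hom.app b ((redDiag D F).hom.app b x) =
    (redDiag D G).hom.app b (f.hom.app b x)
  rw [redDiag_app x (Classical.arbitrary D), redProdMap_evGerm,
    redDiag_app _ (Classical.arbitrary D)]

end ReducedProduct

end DefinableCat

/-! ### Maps into reduced powers, and definable families as subobjects -/

namespace DefinableCat

variable {B : Type u} [SmallCategory B]

/-- Passing to a tail of the system makes the stage carrying `y` the least one, so every stage has a
morphism to `b`. -/
lemma exists_pointed_presents [HasFiniteLimits B] (F : B ⥤ Type u) [PreservesFiniteLimits F]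
    {b : B} (y : F.obj b) :
    ∃ (P : ProSystem B) (h : Presents P F) (i : P.ι) (r : P.obj i ⟶ b),
      (∀ j, i ≤ j) ∧ F.map r (h.elt i) = y := by
  obtain ⟨P, ⟨h⟩⟩ := exists_presents F
  obtain ⟨i, r, rfl⟩ := h.surj y
  have : IsDirectedOrder (Set.Ici i) := ⟨fun j k => by
    obtain ⟨l, hj, hk⟩ := exists_ge_ge j.1 k.1
    exact ⟨⟨l, j.2.trans hj⟩, hj, hk⟩⟩
  refine ⟨{ ι := Set.Ici i, obj := fun j => P.obj j, trans := fun h => P.trans h,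
            trans_refl := fun j => P.trans_refl j, trans_trans := fun h h' => P.trans_trans h h' },
          { elt := fun j => h.elt j, map_trans_elt := fun hij => h.map_trans_elt hij,
            surj := fun {a} x => ?_, inj := fun {a j} s s' hs => ?_ },
          ⟨i, le_rfl⟩, r, fun j => j.2, rfl⟩
  · obtain ⟨j, s, rfl⟩ := h.surj x
    obtain ⟨k, hik, hjk⟩ := exists_ge_ge i j
    exact ⟨⟨k, hik⟩, P.trans hjk ≫ s, by rw [Functor.map_comp_apply, h.map_trans_elt]⟩
  · obtain ⟨k, hk, hs⟩ := h.inj s s' hs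
    exact ⟨⟨k, j.2.trans hk⟩, hk, hs⟩

/-- If `e` lies in all the subobjects in which `y` lies, then `y` can be mapped to `e` by a
morphism into a reduced power. -/
lemma exists_map_redProd [Regular B] {F E : RegFunctor B (Type u)} {b : B} (y : F.obj.obj b)
    (e : E.obj.obj b) (h : ∀ ⦃s : B⦄ (m : s ⟶ b) [Mono m],
      y ∈ Set.range (F.obj.map m) → e ∈ Set.range (E.obj.map m)) :
    ∃ (D : Type u) (_ : PartialOrder D) (_ : IsDirectedOrder D) (_ : Nonempty D)
      (k : F ⟶ redProd fun _ : D => E), k.hom.app b y = (redDiag D E).hom.app b e := by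
  have := F.property.preservesFiniteLimits
  obtain ⟨P, hP, i₀, r, hi₀, rfl⟩ := exists_pointed_presents F.obj y
  -- The image of stage `i` in `b` is a subobject containing `y`, hence `e`; regularity of `E` then
  -- lifts `e` to the stage itself.
  have he (i : P.ι) : ∃ x : E.obj.obj (P.obj i), E.obj.map (P.trans (hi₀ i) ≫ r) x = e := by
    let fac := Regular.strongEpiMonoFactorisation (P.trans (hi₀ i) ≫ r)
    obtain ⟨x, hx⟩ := h fac.m ⟨F.obj.map fac.e (hP.elt i), by
      rw [← Functor.map_comp_apply, fac.fac, Functor.map_comp_apply, hP.map_trans_elt]⟩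
    obtain ⟨z, rfl⟩ := E.property.surjective fac.e inferInstance x
    refine ⟨z, ?_⟩
    rw [← fac.fac, Functor.map_comp_apply, hx]
  choose x hx using he
  -- The lifts `x i` need not be compatible, but their restrictions to stage `i` from all later
  -- stages form a germ, and these germs are compatible.
  let g (i : P.ι) : (redProd fun _ : P.ι => E).obj.obj (P.obj i) :=
    evGerm (E := fun _ => E) i fun j => E.obj.map (P.trans j.2) (x j)
  have hg ⦃i j : P.ι⦄ (hij : i ≤ j) :
      (redProd fun _ : P.ι => E).obj.map (P.trans hij) (g j) = g i := by
    dsimp only [g]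
    rw [map_evGerm, evGerm_restrict hij]
    congr 1
    funext k
    exact (Functor.map_comp_apply _ _ _ _).symm.trans
      (congrArg (fun f => E.obj.map f (x k)) (P.trans_trans hij k.2))
  refine ⟨P.ι, inferInstance, inferInstance, inferInstance,
    ObjectProperty.homMk (hP.desc g hg), ?_⟩
  rw [redDiag_app e i₀]
  change (hP.desc g hg).app _ _ = _
  rw [NatTrans.naturality_apply, hP.desc_app_elt]
  dsimp only [g]
  rw [map_evGerm]
  congr 1
  funext k
  rw [← Functor.map_comp_apply, hx]

/-- The subobjects of `b` in which the element `y` lies, ordered by reverse inclusion. -/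
def SubobjectType (F : RegFunctor B (Type u)) {b : B} (y : F.obj.obj b) : Type u :=
  {s : (Subobject b)ᵒᵈ // y ∈ Set.range (F.obj.map (OrderDual.ofDual s).arrow)}

namespace SubobjectType

variable {F : RegFunctor B (Type u)} {b : B} {y : F.obj.obj b}

instance : PartialOrder (SubobjectType F y) := inferInstanceAs (PartialOrder (Subtype _))

/-- The underlying subobject. -/
def sub (s : SubobjectType F y) : Subobject b := OrderDual.ofDual s.1

lemma mem (s : SubobjectType F y) : y ∈ Set.range (F.obj.map s.sub.arrow) := s.2

lemma sub_le {s t : SubobjectType F y} (h : s ≤ t) : t.sub ≤ s.sub := h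

/-- The subobject represented by a monomorphism. -/
def mk {s : B} (m : s ⟶ b) [Mono m] (h : y ∈ Set.range (F.obj.map m)) : SubobjectType F y :=
  ⟨OrderDual.toDual (Subobject.mk m), by
    obtain ⟨x, rfl⟩ := h
    refine ⟨F.obj.map (Subobject.underlyingIso m).inv x, ?_⟩
    change F.obj.map (Subobject.mk m).arrow _ = _
    rw [← Functor.map_comp_apply, Subobject.underlyingIso_arrow]⟩

lemma exists_fac {s : B} (m : s ⟶ b) [Mono m] (h : y ∈ Set.range (F.obj.map m))
    {t : SubobjectType F y} (ht : mk m h ≤ t) : ∃ f : (t.sub : B) ⟶ s, f ≫ m = t.sub.arrow :=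
  ⟨Subobject.ofLEMk t.sub m (sub_le ht), Subobject.ofLEMk_comp _⟩

instance : Nonempty (SubobjectType F y) := ⟨mk (𝟙 b) ⟨y, F.obj.map_id_apply _ _⟩⟩

instance [HasPullbacks B] : IsDirectedOrder (SubobjectType F y) := ⟨fun s t => by
  have := F.property.preservesFiniteLimits
  obtain ⟨x, hx⟩ := s.mem
  obtain ⟨x', hx'⟩ := t.mem
  obtain ⟨z, h₁, h₂⟩ := exists_of_isPullback F.obj
    (IsPullback.of_hasPullback s.sub.arrow t.sub.arrow) x x' (hx.trans hx'.symm)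
  refine ⟨mk (pullback.fst s.sub.arrow t.sub.arrow ≫ s.sub.arrow) ⟨z, ?_⟩, ?_, ?_⟩
  · rw [Functor.map_comp_apply, h₁, hx]
  · exact Subobject.mk_le_of_comm (pullback.fst _ _) rfl
  · exact Subobject.mk_le_of_comm (pullback.snd _ _) pullback.condition.symm⟩

/-- Beyond the index given by `m` itself, every `e t` lies in `m`, and a germ depends only on a
tail. -/
lemma evGerm_mem [HasPullbacks B] {E : SubobjectType F y → RegFunctor B (Type u)}
    (e : ∀ s, (E s).obj.obj b) (he : ∀ s, e s ∈ Set.range ((E s).obj.map s.sub.arrow))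
    (i : SubobjectType F y) {s : B} (m : s ⟶ b) [Mono m] (h : y ∈ Set.range (F.obj.map m)) :
    evGerm i (fun t => e t) ∈ Set.range ((redProd E).obj.map m) := by
  obtain ⟨k, hik, hk⟩ := exists_ge_ge i (mk m h)
  have key (t : Set.Ici k) : ∃ x, (E t).obj.map m x = e t := by
    obtain ⟨f, hf⟩ := exists_fac m h (hk.trans t.2)
    obtain ⟨x, hx⟩ := he t
    exact ⟨(E t).obj.map f x, by rw [← Functor.map_comp_apply, hf, hx]⟩
  choose x hx using key
  refine ⟨evGerm k x, ?_⟩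
  rw [map_evGerm, evGerm_restrict hik]
  congr 1
  funext t
  exact hx t

end SubobjectType

/-- A family of subsets of the values `G b` of regular functors which is stable under morphisms,
products and (in the sense of reflection) reduced products. -/
structure IsDefinableFamily {b : B} (S : ∀ G : RegFunctor B (Type u), Set (G.obj.obj b)) :
    Prop where
  map {G H : RegFunctor B (Type u)} (f : G ⟶ H) (z : G.obj.obj b) : z ∈ S G →
    f.hom.app b z ∈ S H
  prod {J : Type u} (G : J → RegFunctor B (Type u)) (z : (∏ᶜ G).obj.obj b) :
    (∀ j, (Pi.π G j).hom.app b z ∈ S (G j)) → z ∈ S (∏ᶜ G)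
  germ {D : Type u} [PartialOrder D] [IsDirectedOrder D] [Nonempty D]
    (E : D → RegFunctor B (Type u)) (i : D) (x : ∀ j : Set.Ici i, (E j).obj.obj b) :
    evGerm i x ∈ S (redProd E) → ∃ j : Set.Ici i, x j ∈ S (E j)

namespace IsDefinableFamily

variable [Regular B] {b : B} {S : ∀ G : RegFunctor B (Type u), Set (G.obj.obj b)}

/-- Compactness: otherwise each subobject containing `z` has an element outside `S`. The germ of
these counterexamples lies in every subobject containing `z`, so `z` maps to its diagonal image in a
reduced power; this puts some counterexample in `S`. -/
lemma exists_mono_of_mem (hS : IsDefinableFamily S) {G : RegFunctor B (Type u)} (z : G.obj.obj b) (hz : z ∈ S G) :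
    ∃ (s : B) (m : s ⟶ b), Mono m ∧ z ∈ Set.range (G.obj.map m) ∧
      ∀ H : RegFunctor B (Type u), Set.range (H.obj.map m) ⊆ S H := by
  by_contra! hcon
  have key (s : SubobjectType G z) : ∃ (H : RegFunctor B (Type u)) (w : H.obj.obj b),
      w ∈ Set.range (H.obj.map s.sub.arrow) ∧ w ∉ S H := by
    obtain ⟨H, hH⟩ := hcon _ s.sub.arrow inferInstance s.mem
    obtain ⟨w, hw, hw'⟩ := Set.not_subset.1 hH
    exact ⟨H, w, hw, hw'⟩
  choose H w hw hwS using key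
  let i : SubobjectType G z := Classical.arbitrary _
  obtain ⟨D, _, _, _, k, hk⟩ := exists_map_redProd z
    (evGerm (E := H) i fun t => w t) fun s m _ h => SubobjectType.evGerm_mem w hw i m h
  have h1 := hS.map k z hz
  -- Two reduced products are to be undone: the outer power over `D` and the inner product of the
  -- counterexamples.
  rw [hk, redDiag_app (D := D) _ (Classical.arbitrary D)] at h1
  obtain ⟨-, h2⟩ := hS.germ _ _ _ h1
  obtain ⟨t, h3⟩ := hS.germ _ _ _ h2
  exact hwS t h3

/-- A definable family of subsets is the family of images of a monomorphism. -/
theorem exists_mono (hS : IsDefinableFamily S) : ∃ (s : B) (m : s ⟶ b), Mono m ∧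
    ∀ H : RegFunctor B (Type u), Set.range (H.obj.map m) = S H := by
  by_contra! hcon
  let J := {s : Subobject b // ∀ H : RegFunctor B (Type u), Set.range (H.obj.map s.arrow) ⊆ S H}
  have key (s : J) : ∃ (H : RegFunctor B (Type u)) (w : H.obj.obj b),
      w ∈ S H ∧ w ∉ Set.range (H.obj.map s.1.arrow) := by
    obtain ⟨H, hH⟩ := hcon _ s.1.arrow inferInstance
    obtain ⟨w, hw, hw'⟩ := Set.not_subset.1 fun h => hH ((s.2 H).antisymm h)
    exact ⟨H, w, hw, hw'⟩
  choose H w hw hwS using key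
  -- The tuple of all counterexamples is again in `S`, so it lies in some subobject contained in
  -- `S`. That subobject is one of the indices, and its own counterexample then lies in it.
  obtain ⟨z, hz⟩ := exists_elt_of_family H (preserves_evaluationFunctor_obj B b) w
  obtain ⟨s, m, _, ⟨x, hx⟩, hm⟩ := hS.exists_mono_of_mem z (hS.prod H z fun j => by
    have := hz j
    change (Pi.π H j).hom.app b z = _ at this
    rw [this]
    exact hw j)
  have hfac : (Subobject.underlyingIso m).hom ≫ m = (Subobject.mk m).arrow :=
    Subobject.underlyingIso_hom_comp_eq_mk m
  let j : J := ⟨Subobject.mk m, fun H => by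
    rintro _ ⟨x, rfl⟩
    rw [← hfac, Functor.map_comp_apply]
    exact hm H ⟨_, rfl⟩⟩
  refine hwS j ⟨(H j).obj.map (Subobject.underlyingIso m).inv ((Pi.π H j).hom.app s x), ?_⟩
  rw [← Functor.map_comp_apply]
  change (H j).obj.map ((Subobject.underlyingIso m).inv ≫ (Subobject.mk m).arrow) _ = _
  rw [Subobject.underlyingIso_arrow, ← NatTrans.naturality_apply, hx]
  exact hz j

end IsDefinableFamily

end DefinableCat

/-! ### Supports, and covering `M` by an evaluation functor -/

namespace DefinableCat

variable {B : Type u} [SmallCategory B]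

/-- A regular functor with a weakly universal element at `b`. -/
noncomputable def generic [Regular B] (b : B) : RegFunctor B (Type u) := (exists_generic b).choose

/-- The weakly universal element of `generic b`. -/
noncomputable def genericElt [Regular B] (b : B) : (generic b).obj.obj b :=
  (exists_generic b).choose_spec.choose

lemma exists_generic_hom [Regular B] {b : B} {H : RegFunctor B (Type u)} (z : H.obj.obj b) :
    ∃ f : generic b ⟶ H, f.hom.app b (genericElt b) = z :=
  (exists_generic b).choose_spec.choose_spec.1 H z

lemma exists_fac_of_genericElt [Regular B] {b t a : B} (m : t ⟶ a) [Mono m] (r : b ⟶ a)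
    (h : (generic b).obj.map r (genericElt b) ∈ Set.range ((generic b).obj.map m)) :
    ∃ s : b ⟶ t, s ≫ m = r :=
  (exists_generic b).choose_spec.choose_spec.2 m r h

variable {M : RegFunctor B (Type u) ⥤ Type u}

variable (M) in
/-- The images of `x` under `M` depend only on the images of `y`. -/
def Supports {F : RegFunctor B (Type u)} {b : B} (y : F.obj.obj b) (x : M.obj F) : Prop :=
  ∀ ⦃H : RegFunctor B (Type u)⦄ (f g : F ⟶ H), f.hom.app b y = g.hom.app b y →
    M.map f x = M.map g x

/-- If no stage of a presentation supports `x`, choose at each stage two maps that agree there but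
separate `x`. Since later universal elements determine earlier ones, the two families induce the
same map from `F` to the reduced product, so they agree on `x` at some index. -/
lemma exists_supports [HasFiniteLimits B] (hM : PreservesProductsAndDirectedColimits.{u} M)
    {F : RegFunctor B (Type u)} (x : M.obj F) :
    ∃ (b : B) (y : F.obj.obj b), Supports M y x := by
  have := F.property.preservesFiniteLimits
  obtain ⟨P, ⟨hP⟩⟩ := exists_presents F.obj
  by_contra! hcon
  have key (i : P.ι) : ∃ (H : RegFunctor B (Type u)) (f g : F ⟶ H),
      f.hom.app _ (hP.elt i) = g.hom.app _ (hP.elt i) ∧ M.map f x ≠ M.map g x := by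
    have := hcon _ (hP.elt i)
    simp only [Supports] at this
    push Not at this
    exact this
  choose H f g hfg hne using key
  have heq : redDiag P.ι F ≫ redProdMap f = redDiag P.ι F ≫ redProdMap g := by
    apply ObjectProperty.hom_ext
    apply hP.hom_ext
    intro i
    change (redProdMap f).hom.app _ ((redDiag P.ι F).hom.app _ _) =
      (redProdMap g).hom.app _ ((redDiag P.ι F).hom.app _ _)
    rw [redDiag_app _ i, redProdMap_evGerm, redProdMap_evGerm]
    congr 1
    funext j
    rw [← hP.map_trans_elt (Set.mem_Ici.1 j.2), NatTrans.naturality_apply,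
      NatTrans.naturality_apply, hfg]
  have h1 := ConcreteCategory.congr_hom (congrArg M.map heq) x
  rw [Functor.map_comp_apply, Functor.map_comp_apply, map_redDiag hM _ (Classical.arbitrary _),
    map_redProdMap_germ, map_redProdMap_germ, germ_eq_germ_iff] at h1
  obtain ⟨k, _, _, h⟩ := h1
  exact hne k (h k le_rfl)

/-- The functors `generic s`, for `s` a subobject containing the support `y`, approximate `F` near
`y`. Their reduced product contains a germ `e'` that imitates `y`, and `x` is transferred to an
element `w` that relates to `e'` as `x` does to `y`. A late enough component of `w` is the required
element. -/
lemma exists_generic_supports [Regular B] (hM : PreservesProductsAndDirectedColimits.{u} M)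
    {F : RegFunctor B (Type u)} (x : M.obj F) :
    ∃ (c : B) (w : M.obj (generic c)) (h : generic c ⟶ F),
      Supports M (genericElt c) w ∧ M.map h w = x := by
  obtain ⟨b, y, hy⟩ := exists_supports hM x
  let E (s : SubobjectType F y) : RegFunctor B (Type u) := generic (s.sub : B)
  let e (s : SubobjectType F y) : (E s).obj.obj b := (E s).obj.map s.sub.arrow (genericElt _)
  let i₀ : SubobjectType F y := Classical.arbitrary _
  let e' : (redProd E).obj.obj b := evGerm i₀ fun s => e s
  obtain ⟨D, _, _, _, k, hk⟩ := exists_map_redProd y e' fun s m _ h =>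
    SubobjectType.evGerm_mem e (fun s => ⟨_, rfl⟩) i₀ m h
  -- the element `M.map k x` of the reduced power is constant
  obtain ⟨w, hw⟩ : ∃ w, M.map (redDiag D (redProd E)) w = M.map k x := by
    have h1 : M.map (k ≫ redDiag D _) x =
        M.map (k ≫ redProdMap fun _ => redDiag D (redProd E)) x := by
      -- Both maps send `y` to the twice iterated diagonal image of `e'`.
      apply hy
      have h2 := ConcreteCategory.congr_hom (NatTrans.congr_app (congrArg InducedCategory.Hom.hom
        (redDiag_naturality (D := D) (redDiag D (redProd E)))) b) e'
      change (redDiag D _).hom.app b (k.hom.app b y) = (redProdMap _).hom.app b (k.hom.app b y)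
      rw [hk]
      exact h2.symm
    obtain ⟨i, xs, hxs⟩ := exists_germ hM (M.map k x)
    rw [Functor.map_comp_apply, Functor.map_comp_apply, map_redDiag hM _ i, ← hxs,
      map_redProdMap_germ, germ_eq_germ_iff] at h1
    obtain ⟨j, h, _, hj⟩ := h1
    exact ⟨xs ⟨j, h⟩, (hj j le_rfl).symm.trans hxs⟩
  have hA {H : RegFunctor B (Type u)} (p : redProd E ⟶ H) :
      M.map (redDiag D H) (M.map p w) = M.map (k ≫ redProdMap fun _ => p) x := by
    rw [← Functor.map_comp_apply, ← redDiag_naturality, Functor.map_comp_apply, hw,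
      Functor.map_comp_apply]
  have hB {H : RegFunctor B (Type u)} (p : redProd E ⟶ H) :
      (k ≫ redProdMap fun _ => p).hom.app b y = (redDiag D H).hom.app b (p.hom.app b e') := by
    change (redProdMap _).hom.app b (k.hom.app b y) = _
    rw [hk]
    exact ConcreteCategory.congr_hom (NatTrans.congr_app (congrArg InducedCategory.Hom.hom
        (redDiag_naturality (D := D) p)) b) e'
  -- `hpq` says that `e'` supports `w`, and `hpF` that `w` goes to the image of `x` whenever `e'`
  -- goes to that of `y`. Both are checked after the injective diagonal, where the support property
  -- of `y` applies.
  have hpq {H : RegFunctor B (Type u)} (p q : redProd E ⟶ H)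
      (h : p.hom.app b e' = q.hom.app b e') : M.map p w = M.map q w := by
    apply map_redDiag_injective (D := D) hM
    rw [hA, hA]
    apply hy
    rw [hB, hB, h]
  have hpF {H : RegFunctor B (Type u)} (p : redProd E ⟶ H) (q : F ⟶ H)
      (h : p.hom.app b e' = q.hom.app b y) : M.map p w = M.map q x := by
    apply map_redDiag_injective (D := D) hM
    rw [hA, ← Functor.map_comp_apply]
    apply hy
    rw [hB, h]
    rfl
  obtain ⟨s₁, ws, hws⟩ := exists_germ hM w
  -- eventually, the components of `w` are supported at the generic elements
  have key₁ (s : SubobjectType F y) : ∃ (H : RegFunctor B (Type u)) (f g : E s ⟶ H),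
      f.hom.app _ (genericElt _) = g.hom.app _ (genericElt _) ∧
      ∀ hs : s₁ ≤ s, M.map f (ws ⟨s, hs⟩) = M.map g (ws ⟨s, hs⟩) →
        Supports M (genericElt _) (ws ⟨s, hs⟩) := by
    -- A pair refuting the support if there is one, identities otherwise: `redProdMap` needs
    -- morphisms at every index, even outside the tail above `s₁`.
    by_cases h : ∃ hs : s₁ ≤ s, ¬ Supports M (genericElt _) (ws ⟨s, hs⟩)
    · obtain ⟨hs, h⟩ := h
      simp only [Supports] at h
      push Not at h
      obtain ⟨H, f, g, hfg, hne⟩ := h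
      exact ⟨H, f, g, hfg, fun _ h => absurd h hne⟩
    · push Not at h
      exact ⟨E s, 𝟙 _, 𝟙 _, rfl, fun hs _ => h hs⟩
  choose H f g hfg hsupp using key₁
  have h₁ := hpq (redProdMap f) (redProdMap g) (by
    dsimp only [e']
    rw [redProdMap_evGerm, redProdMap_evGerm]
    congr 1
    funext s
    dsimp only [e]
    rw [NatTrans.naturality_apply, NatTrans.naturality_apply, hfg])
  rw [← hws, map_redProdMap_germ, map_redProdMap_germ, germ_eq_germ_iff] at h₁
  obtain ⟨k₁, hk₁, _, h₁⟩ := h₁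
  -- eventually, the components of `w` are mapped to `x`
  have key₂ (s : SubobjectType F y) : ∃ h : E s ⟶ F, h.hom.app b (e s) = y := by
    obtain ⟨z, hz⟩ := s.mem
    obtain ⟨h, hh⟩ := exists_generic_hom z
    refine ⟨h, ?_⟩
    dsimp only [e]
    rw [NatTrans.naturality_apply, hh, hz]
  choose l hl using key₂
  have h₂ := hpF (redProdMap l) (redDiag _ F) (by
    dsimp only [e']
    rw [redProdMap_evGerm, redDiag_app _ i₀]
    congr 1
    funext s
    exact hl s)
  rw [← hws, map_redProdMap_germ, map_redDiag hM _ s₁, germ_eq_germ_iff] at h₂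
  obtain ⟨k₂, hk₂, _, h₂⟩ := h₂
  obtain ⟨s, hs₁, hs₂⟩ := exists_ge_ge k₁ k₂
  exact ⟨_, ws ⟨s, hk₁.trans hs₁⟩, l s, hsupp s (hk₁.trans hs₁) (h₁ s hs₁), h₂ s hs₂⟩

/-- A functor preserving products and directed colimits is a quotient of an evaluation functor. -/
theorem exists_generic_cover [Regular B] (hM : PreservesProductsAndDirectedColimits.{u} M) :
    ∃ (b : B) (w : M.obj (generic b)), Supports M (genericElt b) w ∧
      ∀ ⦃F : RegFunctor B (Type u)⦄ (x : M.obj F), ∃ h : generic b ⟶ F, M.map h w = x := by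
  by_contra! hcon
  let J := Σ b : B, {w : M.obj (generic b) // Supports M (genericElt b) w}
  -- One counterexample per supported pair; the tuple of all of them comes from a single pair, which
  -- then reaches its own counterexample.
  choose F x hx using fun j : J => hcon j.1 j.2.1 j.2.2
  obtain ⟨z, hz⟩ := exists_elt_of_family F hM x
  obtain ⟨c, w, h, hw, rfl⟩ := exists_generic_supports hM z
  refine hx ⟨c, w, hw⟩ (h ≫ Pi.π F ⟨c, w, hw⟩) ?_
  rw [Functor.map_comp_apply, hz]

lemma Supports.exists_natTrans [Regular B] {b : B} {w : M.obj (generic b)}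
    (hw : Supports M (genericElt b) w) :
    ∃ α : (evaluationFunctor B).obj b ⟶ M, ∀ ⦃F : RegFunctor B (Type u)⦄ (f : generic b ⟶ F),
      α.app F (f.hom.app b (genericElt b)) = M.map f w := by
  choose f hf using fun (F : RegFunctor B (Type u)) (z : F.obj.obj b) => exists_generic_hom z
  refine ⟨{ app := fun F => ↾fun z => M.map (f F z) w, naturality := fun F G g => ?_ },
    fun F g => hw _ _ (hf F _)⟩
  ext z
  change M.map (f G (g.hom.app b z)) w = M.map g (M.map (f F z) w)
  rw [← Functor.map_comp_apply]
  apply hw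
  rw [hf]
  exact congrArg (g.hom.app b) (hf F z).symm

end DefinableCat

/-! ### Evaluation is an equivalence -/

namespace DefinableCat

variable {B : Type u} [SmallCategory B]

lemma isDefinableFamily_eqLocus {M : RegFunctor B (Type u) ⥤ Type u}
    (hM : PreservesProductsAndDirectedColimits.{u} M) {a : B}
    (α β : (evaluationFunctor B).obj a ⟶ M) :
    IsDefinableFamily (b := a) fun G => {z | α.app G z = β.app G z} where
  map {G H} f z hz := by
    have h1 := NatTrans.naturality_apply α f z
    have h2 := NatTrans.naturality_apply β f z
    exact h1.trans ((congrArg (M.map f) hz).trans h2.symm)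
  prod {J} G z hz := by
    refine elt_family_ext G hM fun j => ?_
    have h1 := NatTrans.naturality_apply α (Pi.π G j) z
    have h2 := NatTrans.naturality_apply β (Pi.π G j) z
    exact h1.symm.trans ((hz j).trans h2)
  germ E i x h := by
    have h1 := app_germ (preserves_evaluationFunctor_obj B a) hM α i x
    have h2 := app_germ (preserves_evaluationFunctor_obj B a) hM β i x
    obtain ⟨k, hk, _, h⟩ := (germ_eq_germ_iff hM _ _ _ _).1 (h1.symm.trans (Eq.trans h h2))
    exact ⟨⟨k, hk⟩, h k le_rfl⟩

lemma exists_mono_eqLocus [Regular B] {M : RegFunctor B (Type u) ⥤ Type u}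
    (hM : PreservesProductsAndDirectedColimits.{u} M) {a : B}
    (α β : (evaluationFunctor B).obj a ⟶ M) :
    ∃ (s : B) (m : s ⟶ a), Mono m ∧ ∀ (G : RegFunctor B (Type u)) (z : G.obj.obj a),
      z ∈ Set.range (G.obj.map m) ↔ α.app G z = β.app G z := by
  obtain ⟨s, m, hm, h⟩ := (isDefinableFamily_eqLocus hM α β).exists_mono
  exact ⟨s, m, hm, fun G z => by rw [h]; rfl⟩

section Conservative

variable [Regular B]

/-- A regular functor sees whether a morphism factors through a monomorphism. -/
lemma exists_fac_of_range_subset {t s a : B} (g : t ⟶ a) (m : s ⟶ a) [Mono m]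
    (h : ∀ (G : RegFunctor B (Type u)) (z : G.obj.obj t),
      G.obj.map g z ∈ Set.range (G.obj.map m)) : ∃ k : t ⟶ s, k ≫ m = g :=
  exists_fac_of_genericElt m g (h _ _)

/-- The identity of `a` factors through the equalizer, since it does so in every regular functor. -/
lemma hom_ext_of_regFunctor {a b : B} {f g : a ⟶ b}
    (h : ∀ (G : RegFunctor B (Type u)) (z : G.obj.obj a), G.obj.map f z = G.obj.map g z) :
    f = g := by
  obtain ⟨k, hk⟩ := exists_fac_of_range_subset (𝟙 a) (equalizer.ι f g) fun G z => by
    have := G.property.preservesFiniteLimits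
    obtain ⟨y, hy, -⟩ := (Types.type_equalizer_iff_unique _ _).1
      ⟨isLimitOfHasEqualizerOfPreservesLimit G.obj f g⟩ z (h G z)
    exact ⟨y, hy.trans (G.obj.map_id_apply _ _).symm⟩
  rw [← Category.id_comp f, ← hk, Category.assoc, equalizer.condition, reassoc_of% hk]

lemma isIso_of_bijective {a b : B} (f : a ⟶ b)
    (h : ∀ G : RegFunctor B (Type u), Function.Bijective (G.obj.map f)) : IsIso f := by
  have : Mono f := ⟨fun u v huv => hom_ext_of_regFunctor fun G z => (h G).1 (by
    rw [← Functor.map_comp_apply, ← Functor.map_comp_apply, huv])⟩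
  obtain ⟨k, hk⟩ := exists_fac_of_range_subset (𝟙 b) f fun G z => (h G).2 _
  have : IsSplitEpi f := ⟨⟨⟨k, hk⟩⟩⟩
  exact isIso_of_mono_of_isSplitEpi f

instance faithful_evaluationFunctor : (evaluationFunctor B).Faithful where
  map_injective h := hom_ext_of_regFunctor fun G z =>
    ConcreteCategory.congr_hom (NatTrans.congr_app h G) z

/-- The graph of `γ` is an equalizer locus on `b ⨯ c`, hence a subobject `m`. Its projection to `b`
is bijective in every regular functor, so it is invertible and `m` is the graph of a morphism. -/
instance full_evaluationFunctor : (evaluationFunctor B).Full where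
  map_surjective {b c} γ := by
    obtain ⟨s, m, _, hm⟩ := exists_mono_eqLocus (preserves_evaluationFunctor_obj B c)
      ((evaluationFunctor B).map (prod.fst : b ⨯ c ⟶ b) ≫ γ)
      ((evaluationFunctor B).map (prod.snd : b ⨯ c ⟶ c))
    have hγ (G : RegFunctor B (Type u)) (y : G.obj.obj s) :
        γ.app G (G.obj.map (m ≫ prod.fst) y) = G.obj.map (m ≫ prod.snd) y := by
      rw [Functor.map_comp_apply, Functor.map_comp_apply]
      exact (hm G _).1 ⟨y, rfl⟩
    have hbij (G : RegFunctor B (Type u)) : Function.Bijective (G.obj.map (m ≫ prod.fst)) := by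
      have := G.property.preservesFiniteLimits
      refine ⟨fun y y' h => ?_, fun x => ?_⟩
      · have h' : G.obj.map (m ≫ prod.snd) y = G.obj.map (m ≫ prod.snd) y' := by
          rw [← hγ, ← hγ, h]
        rw [Functor.map_comp_apply, Functor.map_comp_apply] at h h'
        exact map_injective_of_mono G.obj m (prod_ext G.obj h h')
      · obtain ⟨p, rfl, hp⟩ := exists_prod G.obj b c x (γ.app G x)
        obtain ⟨y, rfl⟩ := (hm G p).2 hp.symm
        exact ⟨y, Functor.map_comp_apply _ _ _ _⟩
    have := isIso_of_bijective _ hbij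
    refine ⟨inv (m ≫ prod.fst) ≫ m ≫ prod.snd, ?_⟩
    ext G x
    obtain ⟨y, rfl⟩ := (hbij G).2 x
    refine Eq.trans ?_ (hγ G y).symm
    change G.obj.map _ (G.obj.map _ y) = _
    rw [← Functor.map_comp_apply, IsIso.hom_inv_id_assoc]

/-- A monomorphism `m : r ⟶ b ⨯ b` that induces an equivalence relation on the values of all
regular functors is an equivalence relation. -/
lemma isEquivalenceRelation_of_regFunctor {r b : B} (m : r ⟶ b ⨯ b) [Mono m]
    (h : ∀ G : RegFunctor B (Type u), Equivalence fun x y : G.obj.obj b =>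
      ∃ z, G.obj.map (m ≫ prod.fst) z = x ∧ G.obj.map (m ≫ prod.snd) z = y) :
    IsEquivalenceRelation (m ≫ prod.fst) (m ≫ prod.snd) := by
  have key {t : B} (f g : t ⟶ b) (hfg : ∀ (G : RegFunctor B (Type u)) (z : G.obj.obj t),
      ∃ w, G.obj.map (m ≫ prod.fst) w = G.obj.map f z ∧
        G.obj.map (m ≫ prod.snd) w = G.obj.map g z) :
      ∃ k : t ⟶ r, k ≫ m ≫ prod.fst = f ∧ k ≫ m ≫ prod.snd = g := by
    obtain ⟨k, hk⟩ := exists_fac_of_range_subset (prod.lift f g) m fun G z => by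
      have := G.property.preservesFiniteLimits
      obtain ⟨w, hw₁, hw₂⟩ := hfg G z
      refine ⟨w, prod_ext G.obj ?_ ?_⟩
      · rw [← Functor.map_comp_apply, hw₁, ← Functor.map_comp_apply, prod.lift_fst]
      · rw [← Functor.map_comp_apply, hw₂, ← Functor.map_comp_apply, prod.lift_snd]
    exact ⟨k, by rw [reassoc_of% hk, prod.lift_fst], by rw [reassoc_of% hk, prod.lift_snd]⟩
  have hm : JointlyMono₂ (m ≫ prod.fst) (m ≫ prod.snd) := ⟨fun Y f g h₁ h₂ => by
    rw [← cancel_mono m]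
    ext <;> simpa⟩
  obtain ⟨ρ, hρ₁, hρ₂⟩ := key (𝟙 b) (𝟙 b) fun G z => (h G).refl _
  obtain ⟨σ, hσ₁, hσ₂⟩ := key (m ≫ prod.snd) (m ≫ prod.fst) fun G z => (h G).symm ⟨z, rfl, rfl⟩
  obtain ⟨τ, hτ₁, hτ₂⟩ := key
    (pullback.fst (m ≫ prod.snd) (m ≫ prod.fst) ≫ m ≫ prod.fst)
    (pullback.snd (m ≫ prod.snd) (m ≫ prod.fst) ≫ m ≫ prod.snd) fun G z => by
      refine (h G).trans (y := G.obj.map (pullback.fst _ _ ≫ m ≫ prod.snd) z)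
        ⟨G.obj.map (pullback.fst _ _) z, ?_, ?_⟩ ⟨G.obj.map (pullback.snd _ _) z, ?_, ?_⟩
      · rw [← Functor.map_comp_apply]
      · rw [← Functor.map_comp_apply]
      · rw [← Functor.map_comp_apply, pullback.condition]
      · rw [← Functor.map_comp_apply]
  exact ⟨⟨{ hm with
    r := ρ
    reflexivity₁ := hρ₁
    reflexivity₂ := hρ₂
    s := σ
    symmetry₁ := hσ₁
    symmetry₂ := hσ₂
    c := pullback.cone _ _
    isLimit := pullback.isLimit _ _
    t := τ
    transitivity₁ := hτ₁
    transitivity₂ := hτ₂ }⟩⟩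

end Conservative

/-- Every functor preserving products and directed colimits is an evaluation functor. -/
theorem exists_evaluation_iso [BarrExact B] {M : RegFunctor B (Type u) ⥤ Type u}
    (hM : PreservesProductsAndDirectedColimits.{u} M) :
    ∃ d : B, Nonempty ((evaluationFunctor B).obj d ≅ M) := by
  obtain ⟨b, w, hw, hsurj⟩ := exists_generic_cover hM
  obtain ⟨α, hα⟩ := hw.exists_natTrans
  have hαsurj (G : RegFunctor B (Type u)) (x : M.obj G) : ∃ y : G.obj.obj b, α.app G y = x := by
    obtain ⟨h, rfl⟩ := hsurj x
    exact ⟨_, hα h⟩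
  obtain ⟨r, m, _, hm⟩ := exists_mono_eqLocus hM
    ((evaluationFunctor B).map (prod.fst : b ⨯ b ⟶ b) ≫ α)
    ((evaluationFunctor B).map (prod.snd : b ⨯ b ⟶ b) ≫ α)
  have hker (G : RegFunctor B (Type u)) (x y : G.obj.obj b) :
      (∃ z, G.obj.map (m ≫ prod.fst) z = x ∧ G.obj.map (m ≫ prod.snd) z = y) ↔
        α.app G x = α.app G y := by
    have := G.property.preservesFiniteLimits
    constructor
    · rintro ⟨z, rfl, rfl⟩
      rw [Functor.map_comp_apply, Functor.map_comp_apply]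
      exact (hm G _).1 ⟨z, rfl⟩
    · intro h
      obtain ⟨p, rfl, rfl⟩ := exists_prod G.obj b b x y
      obtain ⟨z, rfl⟩ := (hm G p).2 h
      exact ⟨z, Functor.map_comp_apply _ _ _ _, Functor.map_comp_apply _ _ _ _⟩
  have := isEquivalenceRelation_of_regFunctor m fun G => by
    simp only [hker]
    exact ⟨fun _ => rfl, fun h => h.symm, fun h h' => h.trans h'⟩
  obtain ⟨c, f, hf⟩ := BarrExact.exists_isKernelPair _ _ this
  -- Exactness provides `f` with the right kernel pair but not as a regular epimorphism; its image
  -- factor `q` has the same kernel pair.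
  let q := (Regular.strongEpiMonoFactorisation f).e
  have hfac : q ≫ (Regular.strongEpiMonoFactorisation f).m = f :=
    (Regular.strongEpiMonoFactorisation f).fac
  have hq : IsKernelPair q (m ≫ prod.fst) (m ≫ prod.snd) := by
    rw [← hfac] at hf
    exact IsKernelPair.cancel_right_of_mono hf
  have hqker (G : RegFunctor B (Type u)) (x y : G.obj.obj b) :
      G.obj.map q x = G.obj.map q y ↔ α.app G x = α.app G y := by
    have := G.property.preservesFiniteLimits
    rw [← hker]
    constructor
    · intro h
      exact exists_of_isPullback G.obj hq x y h
    · rintro ⟨z, rfl, rfl⟩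
      rw [← Functor.map_comp_apply, hq.w, Functor.map_comp_apply]
  choose g hg using fun G : RegFunctor B (Type u) =>
    G.property.surjective q (inferInstanceAs (IsRegularEpi (Regular.strongEpiMonoFactorisation f).e))
  -- The value does not depend on the chosen preimage under `q`, since `q` and `α` identify the same
  -- pairs; this also gives naturality and injectivity.
  let β : (evaluationFunctor B).obj (Regular.strongEpiMonoFactorisation f).I ⟶ M :=
    { app G := ↾fun z => α.app G (g G z)
      naturality G H φ := by
        ext z
        change α.app H (g H (φ.hom.app _ z)) = M.map φ (α.app G (g G z))
        refine Eq.trans ?_ (NatTrans.naturality_apply α φ (g G z))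
        refine (hqker H _ _).1 ((hg H _).trans ?_)
        refine Eq.trans ?_ (NatTrans.naturality_apply φ.hom q (g G z))
        exact congrArg (φ.hom.app _) (hg G z).symm }
  have hβ (G : RegFunctor B (Type u)) : IsIso (β.app G) := by
    rw [isIso_iff_bijective]
    refine ⟨fun z z' h => ?_, fun x => ?_⟩
    · rw [← hg G z, ← hg G z']
      exact (hqker G _ _).2 h
    · obtain ⟨y, rfl⟩ := hαsurj G x
      exact ⟨G.obj.map q y, (hqker G _ _).1 (hg G _)⟩
  have := NatIso.isIso_of_isIso_app β
  exact ⟨_, ⟨asIso β⟩⟩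

variable (B) in
/-- The evaluation functor, with values in functors preserving products and directed colimits. -/
def evaluationPlus : B ⥤ Plus.{u} (RegFunctor B (Type u)) :=
  ObjectProperty.lift _ (evaluationFunctor B) (preserves_evaluationFunctor_obj B)

instance [Regular B] : (evaluationPlus B).Faithful :=
  have : (evaluationFunctor B).Faithful := inferInstance
  Functor.Faithful.of_comp_iso ((prodDirected.{u} (RegFunctor B (Type u))).liftCompιIso (evaluationFunctor B)
    (preserves_evaluationFunctor_obj B))

instance [Regular B] : (evaluationPlus B).Full :=
  have : (evaluationFunctor B).Full := inferInstance
  Functor.Full.of_comp_faithful_iso ((prodDirected.{u} (RegFunctor B (Type u))).liftCompιIso (evaluationFunctor B)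
    (preserves_evaluationFunctor_obj B))

instance [BarrExact B] : (evaluationPlus B).EssSurj where
  mem_essImage M := by
    obtain ⟨d, ⟨e⟩⟩ := exists_evaluation_iso M.property
    exact ⟨d, ⟨ObjectProperty.isoMk _ e⟩⟩

instance [BarrExact B] : (evaluationPlus B).IsEquivalence where

end DefinableCat

/-! ### Local finite presentability, and regular functors as a finite-injectivity class -/

namespace DefinableCat

section LocallyFinitelyPresentable

attribute [local instance] Cardinal.fact_isRegular_aleph0

variable {C : Type u} [SmallCategory C]

instance isCardinalPresentable_shrinkYoneda (κ : Cardinal.{u}) [Fact κ.IsRegular] (X : C) :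
    IsCardinalPresentable (shrinkYoneda.{u}.obj X) κ where
  preservesColimitOfShape J _ _ := by
    let e : coyoneda.obj (op (shrinkYoneda.{u}.obj X)) ≅ (evaluation _ (Type u)).obj (op X) :=
      NatIso.ofComponents (fun P => shrinkYonedaEquiv.toIso) fun f => by
        ext g
        exact shrinkYonedaEquiv_comp g f
    exact preservesColimitsOfShape_of_natIso e.symm

variable (C) in
/-- The morphisms of presheaves locality with respect to which expresses the preservation of
limits of shape `J`. -/
noncomputable abbrev preservesLimitsMaps (J : Type) [SmallCategory J] [FinCategory J] :
    MorphismProperty (Cᵒᵖ ⥤ Type u) :=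
  ⨆ (F : J ⥤ Cᵒᵖ), MorphismProperty.ofHoms (Presheaf.preservesLimitHomFamily F)

lemma isCardinalPresentable_of_preservesLimitsMaps (J : Type) [SmallCategory J] [FinCategory J]
    {X Y : Cᵒᵖ ⥤ Type u} (f : X ⟶ Y) (hf : preservesLimitsMaps C J f) :
    IsCardinalPresentable X Cardinal.aleph0.{u} ∧ IsCardinalPresentable Y Cardinal.aleph0.{u} := by
  simp only [preservesLimitsMaps, MorphismProperty.iSup_iff] at hf
  obtain ⟨F, ⟨h⟩⟩ := hf
  refine ⟨?_, by dsimp only [Presheaf.preservesLimitHomFamilyTgt]; infer_instance⟩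
  have := isClosedUnderColimitsOfShape_isCardinalPresentable (Cᵒᵖ ⥤ Type u)
    (κ := Cardinal.aleph0.{u}) (J := Jᵒᵖ) (by
      rw [hasCardinalLT_aleph0_iff]
      infer_instance)
  exact (isCardinalPresentable (Cᵒᵖ ⥤ Type u) Cardinal.aleph0.{u}).prop_colimit
    (F.leftOp ⋙ shrinkYoneda.{u}) fun j => by
      rw [isCardinalPresentable_iff]
      dsimp
      infer_instance

lemma isLocal_preservesLimitsMaps (J : Type) [SmallCategory J] [FinCategory J] :
    (preservesLimitsMaps C J).isLocal = ObjectProperty.preservesLimitsOfShape J :=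
  Presheaf.preservesLimitsOfShape_eq_isLocal.symm

instance isSmall_preservesLimitsMaps (J : Type) [SmallCategory J] [FinCategory J] :
    MorphismProperty.IsSmall.{u} (preservesLimitsMaps C J) :=
  inferInstance

/-- Preserving a limit is locality with respect to a map from a finite colimit of representables to
a representable. The terminal object and pullbacks suffice for all finite limits, so two small sets
of maps between finitely presentable presheaves cut out the lex functors. -/
lemma isLocallyFinitelyPresentable_presheaf_lex [HasFiniteLimits Cᵒᵖ] :
    IsLocallyFinitelyPresentable.{u} (Cᵒᵖ ⥤ₗ Type u) := by
  let W : Bool → MorphismProperty (Cᵒᵖ ⥤ Type u) := fun i =>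
    match i with
    | true => preservesLimitsMaps C (Discrete PEmpty)
    | false => preservesLimitsMaps C WalkingCospan
  have hW : (⨆ i, W i).isLocal = leftExactFunctor Cᵒᵖ (Type u) := by
    rw [MorphismProperty.isLocal_iSup, iInf_bool_eq]
    change (preservesLimitsMaps C _).isLocal ⊓ (preservesLimitsMaps C _).isLocal = _
    rw [isLocal_preservesLimitsMaps, isLocal_preservesLimitsMaps]
    ext P
    refine ⟨fun ⟨h₁, h₂⟩ => ?_, fun h => ⟨?_, ?_⟩⟩
    · have : PreservesLimitsOfShape (Discrete PEmpty.{1}) P := h₁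
      have : PreservesLimitsOfShape WalkingCospan P := h₂
      exact preservesFiniteLimits_of_preservesTerminal_and_pullbacks P
    · have : PreservesFiniteLimits P := h
      exact inferInstanceAs (PreservesLimitsOfShape _ P)
    · have : PreservesFiniteLimits P := h
      exact inferInstanceAs (PreservesLimitsOfShape _ P)
  have : ∀ i, MorphismProperty.IsSmall.{u} (W i) := by
    rintro (_ | _) <;> exact isSmall_preservesLimitsMaps _
  change IsLocallyFinitelyPresentable.{u} (leftExactFunctor Cᵒᵖ (Type u)).FullSubcategory
  rw [← hW]
  refine MorphismProperty.isLocallyPresentable_isLocal _ _ fun X Y f hf => ?_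
  simp only [MorphismProperty.iSup_iff] at hf
  obtain ⟨_ | _, hf⟩ := hf <;> exact isCardinalPresentable_of_preservesLimitsMaps _ f hf

/-- The category of finite limit preserving functors on a small category with finite limits is
locally finitely presentable. -/
theorem isLocallyFinitelyPresentable_lex (B : Type u) [SmallCategory B] [HasFiniteLimits B] :
    IsLocallyFinitelyPresentable.{u} (B ⥤ₗ Type u) := by
  have := isLocallyFinitelyPresentable_presheaf_lex (C := Bᵒᵖ)
  have e : (Bᵒᵖᵒᵖ ⥤ₗ Type u) ≌ (B ⥤ₗ Type u) :=
    ((opOpEquivalence B).congrLeft (E := Type u)).congrFullSubcategory (by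
      ext P
      constructor
      · intro h
        have : PreservesFiniteLimits (opOp B ⋙ P) := h
        have : PreservesFiniteLimits (unopUnop B ⋙ opOp B ⋙ P) := inferInstance
        let α : unopUnop B ⋙ opOp B ⋙ P ≅ P :=
          Functor.isoWhiskerRight (opOpEquivalence B).unitIso.symm P
        exact preservesFiniteLimits_of_natIso α
      · intro h
        have : PreservesFiniteLimits P := h
        exact inferInstanceAs (PreservesFiniteLimits (opOp B ⋙ P)))
  exact e.isCardinalLocallyPresentable _

variable {B : Type u} [SmallCategory B]

/-- By Yoneda the functor to be tested is evaluation at `b`, and filtered colimits of lex functors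
are pointwise. -/
lemma isFinitelyPresentable_lexCoyoneda (b : Bᵒᵖ) :
    IsFinitelyPresentable.{u} ((lexCoyoneda B).obj b) := by
  rw [isFinitelyPresentable_iff_preservesFilteredColimitsOfSize]
  constructor
  intro J _ _
  let e : coyoneda.obj (op ((lexCoyoneda B).obj b)) ≅
      (leftExactFunctor B (Type u)).ι ⋙ (evaluation B (Type u)).obj b.unop :=
    NatIso.ofComponents (fun F => ((leftExactFunctor B (Type u)).fullyFaithfulι.homEquiv.trans
      coyonedaEquiv).toIso) fun f => by
        ext g
        rfl
  have : (leftExactFunctor B (Type u)).IsClosedUnderColimitsOfShape J :=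
    inferInstanceAs (ObjectProperty.preservesFiniteLimits.IsClosedUnderColimitsOfShape J)
  exact preservesColimitsOfShape_of_natIso e.symm

lemma regularFunctor_le_leftExactFunctor :
    regularFunctor B (Type u) ≤ leftExactFunctor B (Type u) :=
  fun _ hF => hF.preservesFiniteLimits

instance full_regToLex : (regToLex B).Full :=
  ObjectProperty.full_ιOfLE regularFunctor_le_leftExactFunctor

instance faithful_regToLex : (regToLex B).Faithful :=
  ObjectProperty.faithful_ιOfLE regularFunctor_le_leftExactFunctor

lemma essImage_regToLex_iff (F : B ⥤ₗ Type u) :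
    (regToLex B).essImage F ↔ IsRegularFunctor F.obj := by
  constructor
  · rintro ⟨G, ⟨e⟩⟩
    let e' : G.obj ≅ F.obj := (leftExactFunctor B (Type u)).ι.mapIso e
    refine ⟨F.property, fun {X Y} f hf => ?_⟩
    rw [isRegularEpi_types_iff]
    intro y
    obtain ⟨x, hx⟩ := G.property.surjective f hf (e'.inv.app Y y)
    refine ⟨e'.hom.app X x, ?_⟩
    rw [← NatTrans.naturality_apply, hx]
    exact ConcreteCategory.congr_hom (e'.inv_hom_id_app Y) y
  · intro hF
    exact ⟨⟨F.obj, hF⟩, ⟨Iso.refl _⟩⟩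

/-- By Yoneda, extending a map along the one induced by `h` is lifting an element along `F.map h`.
-/
lemma essImage_regToLex :
    (regToLex B).essImage = injectivityClass (regEpiMaps B) := by
  ext F
  rw [essImage_regToLex_iff]
  constructor
  · rintro hF _ _ _ ⟨h, hh⟩ f
    obtain ⟨y, hy⟩ := hF.surjective h hh (coyonedaEquiv f.hom)
    refine ⟨ObjectProperty.homMk (coyonedaEquiv.symm y), ?_⟩
    apply ObjectProperty.hom_ext
    apply coyonedaEquiv.injective
    refine Eq.trans ?_ hy
    exact (congrArg coyonedaEquiv (coyonedaEquiv_symm_map h y)).symm.trans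
      (coyonedaEquiv.apply_symm_apply _)
  · intro h
    refine ⟨F.property, fun {X Y} f hf => ?_⟩
    rw [isRegularEpi_types_iff]
    intro y
    obtain ⟨g, hg⟩ := h _ (regEpiMaps.of f hf) (ObjectProperty.homMk (coyonedaEquiv.symm y))
    refine ⟨coyonedaEquiv g.hom, ?_⟩
    have := congrArg (fun k : (lexCoyoneda B).obj (op Y) ⟶ F => coyonedaEquiv k.hom) hg
    exact (coyonedaEquiv_naturality g.hom f).trans
      (this.trans (coyonedaEquiv.apply_symm_apply y))

instance isSmall_regEpiMaps : MorphismProperty.IsSmall.{u} (regEpiMaps B) := by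
  have : regEpiMaps B = MorphismProperty.ofHoms
      fun f : {f : Arrow B // IsRegularEpi f.hom} => (lexCoyoneda B).map f.1.hom.op := by
    ext X Y f
    constructor
    · rintro ⟨h, hh⟩
      exact ⟨(⟨Arrow.mk h, hh⟩ : {f : Arrow B // IsRegularEpi f.hom})⟩
    · rintro ⟨f⟩
      exact .of _ f.2
  rw [this]
  have : Small.{u} (Arrow B) := by
    have : Function.Injective fun f : Arrow B => (⟨f.left, f.right, f.hom⟩ : Σ X Y : B, X ⟶ Y) := by
      rintro ⟨X, Y, f⟩ ⟨X', Y', f'⟩ h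
      obtain ⟨rfl, h⟩ := Sigma.mk.inj_iff.1 h
      obtain ⟨rfl, h⟩ := Sigma.mk.inj_iff.1 (eq_of_heq h)
      obtain rfl := eq_of_heq h
      rfl
    exact small_of_injective this
  infer_instance

lemma isFiniteInjectivityClassOf_regEpiMaps :
    IsFiniteInjectivityClassOf.{u} (regToLex B).essImage (regEpiMaps B) where
  isSmall := inferInstance
  finitelyPresentable_source := by
    rintro _ _ _ ⟨h, hh⟩
    exact isFinitelyPresentable_lexCoyoneda _
  finitelyPresentable_target := by
    rintro _ _ _ ⟨h, hh⟩
    exact isFinitelyPresentable_lexCoyoneda _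
  eq_injectivityClass := essImage_regToLex

/-- Finite-injectivity classes are closed under pure subobjects. -/
lemma IsFiniteInjectivityClassOf.of_isPureMorphism {K : Type u'} [Category.{v} K]
    {P : ObjectProperty K} {M : MorphismProperty K} (hP : IsFiniteInjectivityClassOf.{w} P M)
    {X Y : K} (f : X ⟶ Y) (hf : IsPureMorphism.{w} f) (hY : P Y) : P X := by
  rw [hP.eq_injectivityClass] at hY ⊢
  intro U V h hh g
  obtain ⟨k, hk⟩ := hY h hh (g ≫ f)
  exact hf h g k (hP.finitelyPresentable_source h hh) (hP.finitelyPresentable_target h hh) hk.symm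

lemma isDefinableSubcategory_essImage_regToLex [HasFiniteLimits B] :
    IsDefinableSubcategory.{u} (regToLex B).essImage where
  products J := ⟨by
    rintro F ⟨h⟩
    rw [essImage_regToLex_iff]
    have : (leftExactFunctor B (Type u)).IsClosedUnderLimitsOfShape (Discrete J) :=
      isClosedUnderLimitsOfShape_preservesFiniteLimits (Discrete J)
    exact (regularFunctor B (Type u)).prop_of_isLimit
      (isLimitOfPreserves (leftExactFunctor B (Type u)).ι h.isLimit) fun j =>
        (essImage_regToLex_iff _).1 (h.prop_diag_obj j)⟩
  directedColimits J _ _ _ := ⟨by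
    rintro F ⟨h⟩
    rw [essImage_regToLex_iff]
    have : (leftExactFunctor B (Type u)).IsClosedUnderColimitsOfShape J :=
      inferInstanceAs (ObjectProperty.preservesFiniteLimits.IsClosedUnderColimitsOfShape J)
    exact (regularFunctor B (Type u)).prop_of_isColimit
      (isColimitOfPreserves (leftExactFunctor B (Type u)).ι h.isColimit) fun j =>
        (essImage_regToLex_iff _).1 (h.prop_diag_obj j)⟩
  pureSubobjects f _ := isFiniteInjectivityClassOf_regEpiMaps.of_isPureMorphism f

theorem isDefinableCategory_regFunctor [HasFiniteLimits B] :
    IsDefinableCategory.{u} (RegFunctor B (Type u)) :=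
  ⟨B ⥤ₗ Type u, inferInstance, isLocallyFinitelyPresentable_lex B, (regToLex B).essImage,
    isDefinableSubcategory_essImage_regToLex, ⟨(regToLex B).toEssImage.asEquivalence⟩⟩

end LocallyFinitelyPresentable

end DefinableCat

theorem theorem3p1p5 (B : Type u) [SmallCategory B] [DefinableCat.BarrExact B] :
    DefinableCat.IsDefinableCategory.{u} (DefinableCat.RegFunctor B (Type u)) ∧
    (IsLocallyFinitelyPresentable.{u} (B ⥤ₗ Type u) ∧
      (DefinableCat.regToLex B).Full ∧ (DefinableCat.regToLex B).Faithful ∧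
      DefinableCat.IsFiniteInjectivityClassOf.{u}
        (DefinableCat.regToLex B).essImage (DefinableCat.regEpiMaps B)) ∧
    ∃ e : B ≌ DefinableCat.Plus.{u} (DefinableCat.RegFunctor B (Type u)),
      Nonempty (e.functor ⋙ (DefinableCat.prodDirected.{u} (DefinableCat.RegFunctor B (Type u))).ι ≅
        DefinableCat.evaluationFunctor B) :=
  ⟨DefinableCat.isDefinableCategory_regFunctor,
    ⟨DefinableCat.isLocallyFinitelyPresentable_lex B, inferInstance, inferInstance,
      DefinableCat.isFiniteInjectivityClassOf_regEpiMaps⟩,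
    (DefinableCat.evaluationPlus B).asEquivalence, ⟨Iso.refl _⟩⟩
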